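/- Let $r>0$, $x^{*}>0$, $\lambda>0$, $\alpha>0$, $\delta\ge 0$ and $x\ge x^{*}$. Let $0=T_0<T_1<T_2<\dots$ be the event times of a Poisson process with intensity $\lambda$, and let $(Z_i)_{i\ge1}$ be i.i.d. random variables, independent of this process, with distribution $\mathrm{Beta}(\alpha,1)$. Let $(X_t)_{t\ge0}$ be the household capital process with $X_0=x$ that satisfies, for $T_{i-1}\le t<T_i$, $$X_t=\begin{cases}(X_{T_{i-1}}-x^{*})e^{r(t-T_{i-1})}+x^{*} & \text{if } X_{T_{i-1}}>x^{*},\\ X_{T_{i-1}} & \text{otherwise,}\end{cases}$$ and, at the event times, $$X_{T_i}=\begin{cases}\left[(X_{T_{i-1}}-x^{*})e^{r(T_i-T_{i-1})}+x^{*}\right]Z_i & \text{if } X_{T_{i-1}}>x^{*},\\ X_{T_{i-1}}Z_i & \text{otherwise.}\end{cases}$$ Let $\tau_x=\inf\{t\ge0: X_t<x^{*}\}$ (with $\inf\emptyset=\infty$) be the trapping time and let $m_\delta(x)=\mathbb{E}\left[e^{-\delta\tau_x}\mathbf 1_{\{\tau_x<\infty\}}\right]$ be its Laplace transform, that is, the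 Gerber–Shiu expected discounted penalty function $\mathbb{E}\left[w(X_{\tau_x^-}-x^{*},|X_{\tau_x}-x^{*}|)e^{-\delta\tau_x}\mathbf 1_{\{\tau_x<\infty\}}\right]$ with penalty $w\equiv1$. Put $$a=\frac{-(\delta+\lambda-\alpha r)-\sqrt{(\delta+\lambda-\alpha r)^2+4r\alpha\delta}}{2r},\qquad b=\frac{-(\delta+\lambda-\alpha r)+\sqrt{(\delta+\lambda-\alpha r)^2+4r\alpha\delta}}{2r},$$ and let ${}_2F_1(p,q;s;z)=\sum_{n\ge0}\frac{(p)_n(q)_n}{(s)_n}\frac{z^n}{n!}$ be Gauss's hypergeometric function, where $(p)_n=p(p+1)\cdots(p+n-1)$. Then the series ${}_2F_1(b,b-\alpha+1;b-a+1;z)$ converges for $0\le z\le1$, its value at $z=1$ is not zero, and $$m_\delta(x)=\frac{\lambda\;{}_2F_1\left(b,\,b-\alpha+1;\,b-a+1;\,\frac{x^{*}}{x}\right)}{(\lambda+\delta)\;{}_2F_1\left(b,\,b-\alpha+1;\,b-a+1;\,1\right)}\left(\frac{x}{x^{*}}\right)^{-b}.$$ -/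

import Mathlib

open MeasureTheory ProbabilityTheory
open scoped NNReal ENNReal

/-- `T` is the sequence of event times of a Poisson process of intensity `lam`: `T 0 = 0` and the
inter-arrival times `T (i + 1) - T i` are independent, exponentially distributed with rate `lam`.
The Poisson process itself is the counting process `t ↦ eventCount (T · ω) t`. -/
structure IsPoissonEventTimes {Ω : Type*} [MeasurableSpace Ω] (T : ℕ → Ω → ℝ) (lam : ℝ)
    (P : Measure Ω) : Prop where
  measurable : ∀ i, Measurable (T i)
  zero : ∀ ω, T 0 ω = 0
  hasLaw : ∀ i, HasLaw (fun ω => T (i + 1) ω - T i ω) (expMeasure lam) P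
  iIndepFun : iIndepFun (fun (i : ℕ) ω => T (i + 1) ω - T i ω) P

namespace Household

noncomputable section

/-- The number `N_t` of events in `(0, t]`, where `T 1, T 2, …` are the event times. -/
def eventCount (T : ℕ → ℝ) (t : ℝ) : ℕ :=
  {i : ℕ | 1 ≤ i ∧ T i ≤ t}.ncard

/-- The capital after a time `s` without loss events, started from capital `u`: the surplus above
the critical capital `xs` grows exponentially with rate `r`; at or below `xs` nothing changes. -/
def grow (r xs s u : ℝ) : ℝ :=
  if xs < u then (u - xs) * Real.exp (r * s) + xs else u

/-- The capital at the event time `T i`, after the loss. The proportion that remains after the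
loss at time `T (i + 1)` is `Z i`, so that the sequence of proportions is `Z 0, Z 1, …`. -/
def eventCapital (r xs x : ℝ) (T Z : ℕ → ℝ) : ℕ → ℝ
  | 0 => x
  | i + 1 => grow r xs (T (i + 1) - T i) (eventCapital r xs x T Z i) * Z i

/-- A path of the capital process: if `T i ≤ t < T (i + 1)`, that is, if `i = N_t`, then
the capital at time `t` has grown for a time `t - T i` from the capital at time `T i`. -/
def capital (r xs x : ℝ) (T Z : ℕ → ℝ) (t : ℝ≥0) : ℝ :=
  grow r xs ((t : ℝ) - T (eventCount T t)) (eventCapital r xs x T Z (eventCount T t))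

/-- The trapping time, the infimum of the times at which the capital is below `xs`; it is `∞`
if there is no such time. -/
def trappingTime (r xs x : ℝ) (T Z : ℕ → ℝ) : ℝ≥0∞ :=
  ⨅ (t : ℝ≥0) (_ : capital r xs x T Z t < xs), (t : ℝ≥0∞)

/-- The Gerber-Shiu expected discounted penalty function with force of interest `δ` and penalty
`w`, as a function of the initial capital `x`:
`E [w (X_{τ-} - xs, |X_τ - xs|) * exp (-δ τ) ; τ < ∞]`. -/
def gerberShiu {Ω : Type*} [MeasurableSpace Ω] (P : Measure Ω) (T Z : ℕ → Ω → ℝ) (r xs δ : ℝ)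
    (w : ℝ → ℝ → ℝ) (x : ℝ) : ℝ :=
  ∫ ω, {ω | trappingTime r xs x (T · ω) (Z · ω) < ∞}.indicator
    (fun ω =>
      let X : ℝ≥0 → ℝ := capital r xs x (T · ω) (Z · ω)
      let τ : ℝ≥0 := (trappingTime r xs x (T · ω) (Z · ω)).toNNReal
      w (Function.leftLim X τ - xs) |X τ - xs| * Real.exp (-δ * τ)) ω ∂P

/-- The Laplace transform of the trapping time: the Gerber-Shiu function with penalty `1`. -/
def trappingLaplace {Ω : Type*} [MeasurableSpace Ω] (P : Measure Ω) (T Z : ℕ → Ω → ℝ)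
    (r xs δ x : ℝ) : ℝ :=
  gerberShiu P T Z r xs δ (fun _ _ => 1) x

end

end Household

open Filter Topology

/-! Put v = x / xs and F(v) = ∑ c n * v ^ (-b - n), with c the coefficients of the Gauss series.
Conditioning on the first event gives the renewal equation m(x) = E[exp(-δ S) m(Y Z)], where S is
the waiting time, Y the capital grown up to S, and m = 1 below xs. An intermediate function G(v) = ∑
d n * v ^ (-b - n) splits it into two first-order equations: α G + v G' = α F for the beta loss, and
(lam + δ) F - r (v - 1) F' = lam G for exponential waiting with growth. On coefficients, eliminating
d leaves the quadratic equation for b and the hypergeometric recurrence (`shiftedCoefficient_mul`).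
The parameter excess of the Gauss series is (δ + lam) / r > 0, so it converges absolutely up to z =
1, that is, down to the critical capital. Hence F solves the renewal equation with the constant κ =
G(1) = (lam + δ) F(1) / lam below xs (`integral_prod_extendBelow`), and F / κ is the asserted
formula.

Uniqueness for b > 0 comes from a maximum principle (`eq_zero_of_le_discountedNext`): a bounded
subsolution that is zero below xs and vanishes at infinity is zero, because from a bounded range of
capitals trapping at the next event has probability bounded away from 0. It shows that F(1) ≠ 0
(otherwise F would vanish, although c 0 = 1), that F / κ ≥ 0, and that F / κ equals the limit of the
discounted probabilities of trapping within n events. If b = 0, then δ = 0 and α r ≤ lam, the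
formula reads 1, and F does not decay; certain trapping then follows from the logarithmic
supersolution of `discountedNext_log_le`.

On the side of the process, growth never crosses xs, so trapping happens at an event. The stopped
chain of capitals at event times is Markov, and dominated convergence identifies the Laplace
transform with the same limit (`trappingLaplace_eq`). -/

/-! ### Hypergeometric coefficients: recurrence, summability, decay -/

theorem ordinaryHypergeometricCoefficient_zero (p q s : ℝ) :
    ordinaryHypergeometricCoefficient p q s 0 = 1 := by
  simp [ordinaryHypergeometricCoefficient]

theorem ordinaryHypergeometricCoefficient_succ {p q s : ℝ} (hs : 0 < s) (n : ℕ) :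
    (n + 1) * (s + n) * ordinaryHypergeometricCoefficient p q s (n + 1) =
      (p + n) * (q + n) * ordinaryHypergeometricCoefficient p q s n := by
  have h1 : (n.factorial : ℝ) ≠ 0 := by positivity
  have h2 : (ascPochhammer ℝ n).eval s ≠ 0 := (ascPochhammer_pos n s hs).ne'
  have h3 : s + n ≠ 0 := by positivity
  have h4 : (n : ℝ) + 1 ≠ 0 := by positivity
  simp only [ordinaryHypergeometricCoefficient, Nat.factorial_succ, ascPochhammer_succ_eval]
  push_cast
  field_simp

theorem ordinaryHypergeometric_eq_tsum_mul_pow (p q s z : ℝ) :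
    ₂F₁ p q s z = ∑' n, ordinaryHypergeometricCoefficient p q s n * z ^ n := by
  rw [ordinaryHypergeometric_eq_tsum]
  rfl

/-- A Raabe type test for a sequence with a hypergeometric recurrence. -/
theorem summable_abs_of_hypergeometric_recurrence {p q s : ℝ} (hs : 0 < s) (hpq : 0 < s - p - q)
    {c : ℕ → ℝ} (hc : ∀ n : ℕ, (n + 1) * (s + n) * c (n + 1) = (p + n) * (q + n) * c n) :
    Summable fun n => |c n| := by
  set ε := s - p - q with hε
  obtain ⟨N, hN⟩ : ∃ N : ℕ, ∀ n : ℕ, N ≤ n → 0 ≤ p + n ∧ 0 ≤ q + n ∧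
      ε / 2 * (s + n) ≤ ε * n - p * q := by
    have h (x : ℝ) : ∀ᶠ n : ℕ in atTop, x ≤ n :=
      tendsto_natCast_atTop_atTop.eventually_ge_atTop x
    have := (h (-p)).and ((h (-q)).and (h ((p * q + ε / 2 * s) / (ε / 2))))
    obtain ⟨N, hN⟩ := eventually_atTop.1 this
    refine ⟨N, fun n hn => ?_⟩
    obtain ⟨h1, h2, h3⟩ := hN n hn
    rw [div_le_iff₀ (by positivity)] at h3
    exact ⟨by linarith, by linarith, by nlinarith⟩
  -- The recurrence gives (s + n) (n |c n| - (n + 1) |c (n + 1)|) = (ε n - p q) |c n|, so ∑ |c n| is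
  -- dominated by a telescoping sum.
  have key (n : ℕ) (hn : N ≤ n) :
      ε / 2 * |c n| ≤ n * |c n| - (n + 1 : ℕ) * |c (n + 1)| := by
    obtain ⟨h1, h2, h3⟩ := hN n hn
    have hsn : 0 < s + n := by positivity
    have h4 : (n + 1) * (s + n) * |c (n + 1)| = (p + n) * (q + n) * |c n| := by
      have := congrArg abs (hc n)
      rw [abs_mul, abs_mul ((p + n) * (q + n)), abs_of_nonneg (mul_nonneg h1 h2),
        abs_of_nonneg (by positivity)] at this
      exact this
    refine le_of_mul_le_mul_left ?_ hsn
    push_cast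
    have : (s + n) * (n * |c n| - (n + 1) * |c (n + 1)|) = (ε * n - p * q) * |c n| := by
      rw [mul_sub, show (s + n) * ((n + 1) * |c (n + 1)|) = (p + n) * (q + n) * |c n| by
        rw [← h4]; ring, hε]
      ring
    rw [this]
    nlinarith [abs_nonneg (c n)]
  rw [← summable_nat_add_iff N]
  refine summable_of_sum_range_le (c := N * |c N| / (ε / 2)) (fun n => abs_nonneg _) fun n => ?_
  rw [le_div_iff₀ (by positivity), mul_comm, Finset.mul_sum]
  calc ∑ i ∈ Finset.range n, ε / 2 * |c (i + N)|
      ≤ ∑ i ∈ Finset.range n, (((i + N : ℕ) : ℝ) * |c (i + N)|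
          - ((i + 1 + N : ℕ) : ℝ) * |c (i + 1 + N)|) := by
        refine Finset.sum_le_sum fun i _ => ?_
        have := key (i + N) (by omega)
        rwa [show i + 1 + N = i + N + 1 by omega]
    _ = N * |c N| - ((n + N : ℕ) : ℝ) * |c (n + N)| := by
        rw [Finset.sum_range_sub' fun i => ((i + N : ℕ) : ℝ) * |c (i + N)|]
        simp
    _ ≤ N * |c N| := by
        have : 0 ≤ ((n + N : ℕ) : ℝ) * |c (n + N)| := by positivity
        linarith

/-- The increments of n * c n are bounded multiples of c n, hence summable, so n * c n converges. A
nonzero limit would make ∑ |c n| dominate the harmonic series. -/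
theorem tendsto_natCast_mul_of_hypergeometric_recurrence {p q s : ℝ} (hs : 0 < s)
    {c : ℕ → ℝ} (hc : ∀ n : ℕ, (n + 1) * (s + n) * c (n + 1) = (p + n) * (q + n) * c n)
    (hsum : Summable fun n => |c n|) :
    Tendsto (fun n : ℕ => (n : ℝ) * c n) atTop (𝓝 0) := by
  have hd (n : ℕ) : (n + 1 : ℕ) * c (n + 1) - n * c n =
      ((p + q - s) * n + p * q) / (s + n) * c n := by
    have hsn : s + n ≠ 0 := by positivity
    have := hc n
    field_simp
    push_cast
    linear_combination this
  have hdb (n : ℕ) : |((p + q - s) * n + p * q) / (s + n)| ≤ |p + q - s| + |p * q| / s := by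
    have hsn : 0 < s + n := by positivity
    rw [abs_div, abs_of_pos hsn, div_le_iff₀ hsn]
    calc |(p + q - s) * n + p * q| ≤ |p + q - s| * n + |p * q| := by
          refine (abs_add_le _ _).trans_eq ?_
          rw [abs_mul (p + q - s), abs_of_nonneg (Nat.cast_nonneg (α := ℝ) n)]
      _ ≤ |p + q - s| * (s + n) + |p * q| / s * (s + n) := by
          have h1 : |p * q| / s * (s + n) = |p * q| + |p * q| / s * n := by field_simp
          have h2 : 0 ≤ |p * q| / s * n := by positivity
          nlinarith [abs_nonneg (p + q - s)]
      _ = _ := by ring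
  have hds : Summable fun n : ℕ => (n + 1 : ℕ) * c (n + 1) - n * c n := by
    refine Summable.of_norm_bounded (hsum.mul_left (|p + q - s| + |p * q| / s)) fun n => ?_
    rw [hd, Real.norm_eq_abs, abs_mul]
    exact mul_le_mul_of_nonneg_right (hdb n) (abs_nonneg _)
  obtain ⟨L, hL⟩ : ∃ L, Tendsto (fun n : ℕ => (n : ℝ) * c n) atTop (𝓝 L) := by
    refine ⟨_, hds.hasSum.tendsto_sum_nat.congr fun n => ?_⟩
    rw [Finset.sum_range_sub fun n : ℕ => (n : ℝ) * c n]
    simp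
  suffices L = 0 by rwa [this] at hL
  by_contra hne
  have hev : ∀ᶠ n : ℕ in atTop, |L| / 2 < |(n : ℝ) * c n| :=
    hL.abs.eventually_const_lt (by linarith [abs_pos.2 hne])
  refine Real.not_summable_one_div_natCast ?_
  refine (hsum.mul_left (2 / |L|)).of_norm_bounded_eventually_nat ?_
  filter_upwards [hev, eventually_gt_atTop 0] with n hn hn0
  have hn0' : (0 : ℝ) < n := by exact_mod_cast hn0
  have hL0 : 0 < |L| := abs_pos.2 hne
  rw [abs_mul, abs_of_pos hn0'] at hn
  rw [Real.norm_eq_abs, abs_of_pos (by positivity), div_le_iff₀ hn0', div_mul_eq_mul_div,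
    div_mul_eq_mul_div, le_div_iff₀ hL0]
  linarith

/-! ### Coefficients of the intermediate function -/

/-- The coefficients of the power series of `(1 - z) * ∑ (b + n) c n z ^ n`, with the
multiples of `c` that occur in the equation for the capital process. -/
noncomputable def shiftedCoefficient (lam δ r b : ℝ) (c : ℕ → ℝ) : ℕ → ℝ
  | 0 => ((lam + δ) * c 0 + r * (b * c 0)) / lam
  | n + 1 => ((lam + δ) * c (n + 1) + r * ((b + (n + 1 : ℕ)) * c (n + 1) - (b + n) * c n)) / lam

/-- This is α G + v G' = α F on coefficients. For n = 0 it is the quadratic equation of b; for later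
n it combines that equation, the sum of the roots and the hypergeometric recurrence. -/
theorem shiftedCoefficient_mul {lam δ r α a b : ℝ} (hr : 0 < r) (hlam : 0 < lam)
    (hab : a + b = -(δ + lam - α * r) / r)
    (hb : r * b ^ 2 + (δ + lam - α * r) * b - α * δ = 0) {c : ℕ → ℝ}
    (hc : ∀ n : ℕ, (n + 1) * (b - a + 1 + n) * c (n + 1) = (b + n) * (b - α + 1 + n) * c n)
    (n : ℕ) :
    shiftedCoefficient lam δ r b c n * (α - b - n) = α * c n := by
  have ha : r * (a + b) = -(δ + lam - α * r) := by rw [hab]; field_simp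
  cases n with
  | zero =>
    simp only [shiftedCoefficient]
    field_simp
    push_cast
    linear_combination (-c 0) * hb
  | succ n =>
    simp only [shiftedCoefficient]
    field_simp
    push_cast
    have h2 : lam = -δ + α * r - r * (a + b) := by linarith
    linear_combination (-c (n + 1)) * hb + (-r) * hc n - (n + 1) * c (n + 1) * ha

theorem sum_range_succ_shiftedCoefficient {lam δ r b : ℝ} (c : ℕ → ℝ) (n : ℕ) :
    ∑ i ∈ Finset.range (n + 1), shiftedCoefficient lam δ r b c i =
      ((lam + δ) * ∑ i ∈ Finset.range (n + 1), c i + r * ((b + n) * c n)) / lam := by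
  induction n with
  | zero => simp [shiftedCoefficient]
  | succ n ih =>
    rw [Finset.sum_range_succ, ih, Finset.sum_range_succ c (n + 1)]
    simp only [shiftedCoefficient]
    push_cast
    ring

theorem summable_abs_shiftedCoefficient {lam δ r α b : ℝ} {c : ℕ → ℝ}
    (he : ∀ n : ℕ, shiftedCoefficient lam δ r b c n * (α - b - n) = α * c n)
    (hsum : Summable fun n => |c n|) :
    Summable fun n => |shiftedCoefficient lam δ r b c n| := by
  refine (hsum.mul_left |α|).of_norm_bounded_eventually_nat ?_
  filter_upwards [tendsto_natCast_atTop_atTop.eventually_ge_atTop (α - b + 1)] with n hn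
  rw [Real.norm_eq_abs, abs_abs, ← abs_mul, ← he n, abs_mul]
  refine le_mul_of_one_le_right (abs_nonneg _) ?_
  rw [le_abs]
  right
  linarith

/-- The partial sums telescope up to the boundary term r (b + n) c n, which tends to 0. The result
is the renewal equation at capital exactly xs, where nothing grows. -/
theorem tsum_shiftedCoefficient {lam δ r b : ℝ} {c : ℕ → ℝ}
    (hsum : Summable fun n => |c n|) (hlim : Tendsto (fun n : ℕ => (n : ℝ) * c n) atTop (𝓝 0))
    (hsum' : Summable fun n => |shiftedCoefficient lam δ r b c n|) :
    ∑' n, shiftedCoefficient lam δ r b c n = (lam + δ) * (∑' n, c n) / lam := by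
  have h1 := (tendsto_add_atTop_iff_nat 1).2 hsum'.of_abs.hasSum.tendsto_sum_nat
  refine tendsto_nhds_unique h1 ?_
  simp_rw [sum_range_succ_shiftedCoefficient]
  have h2 := (tendsto_add_atTop_iff_nat 1).2 hsum.of_abs.hasSum.tendsto_sum_nat
  have h3 : Tendsto (fun n : ℕ => (b + n) * c n) atTop (𝓝 0) := by
    have := (hsum.of_abs.tendsto_atTop_zero.const_mul b).add hlim
    simp only [mul_zero, add_zero] at this
    exact this.congr fun n => by ring
  have := ((h2.const_mul (lam + δ)).add (h3.const_mul r)).div_const lam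
  simpa using this

/-! ### Analysis of the series in z and in v = 1 / z -/

/-- The sum of the power series with coefficients `c`. -/
noncomputable def powerSum (c : ℕ → ℝ) (z : ℝ) : ℝ := ∑' n, c n * z ^ n

theorem summable_mul_pow {c : ℕ → ℝ} (hc : Summable fun n => |c n|) {z : ℝ}
    (hz : z ∈ Set.Icc (0 : ℝ) 1) : Summable fun n => c n * z ^ n := by
  refine hc.of_norm_bounded fun n => ?_
  rw [Real.norm_eq_abs, abs_mul, abs_of_nonneg (pow_nonneg hz.1 n)]
  exact mul_le_of_le_one_right (abs_nonneg _) (pow_le_one₀ hz.1 hz.2)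

theorem abs_powerSum_le {c : ℕ → ℝ} (hc : Summable fun n => |c n|) {z : ℝ}
    (hz : z ∈ Set.Icc (0 : ℝ) 1) : |powerSum c z| ≤ ∑' n, |c n| := by
  refine tsum_of_norm_bounded (f := fun n => c n * z ^ n) hc.hasSum fun n => ?_
  rw [Real.norm_eq_abs, abs_mul, abs_of_nonneg (pow_nonneg hz.1 n)]
  exact mul_le_of_le_one_right (abs_nonneg _) (pow_le_one₀ hz.1 hz.2)

theorem continuousOn_powerSum {c : ℕ → ℝ} (hc : Summable fun n => |c n|) :
    ContinuousOn (powerSum c) (Set.Icc 0 1) := by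
  refine continuousOn_tsum (fun n => by fun_prop) hc fun n z hz => ?_
  rw [Real.norm_eq_abs, abs_mul, abs_of_nonneg (pow_nonneg hz.1 n)]
  exact mul_le_of_le_one_right (abs_nonneg _) (pow_le_one₀ hz.1 hz.2)

theorem summable_natCast_mul_mul_pow {c : ℕ → ℝ} (hc : Summable fun n => |c n|) {z : ℝ}
    (hz : z ∈ Set.Ico (0 : ℝ) 1) : Summable fun n : ℕ => n * c n * z ^ n := by
  have hb (n : ℕ) : |c n| ≤ ∑' n, |c n| := hc.le_tsum n fun _ _ => abs_nonneg _
  have hg : Summable fun n : ℕ => (n : ℝ) ^ 1 * z ^ n :=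
    summable_pow_mul_geometric_of_norm_lt_one 1 (by
      rw [Real.norm_eq_abs, abs_of_nonneg hz.1]; exact hz.2)
  refine (hg.mul_left (∑' n, |c n|)).of_norm_bounded fun n => ?_
  rw [Real.norm_eq_abs, abs_mul, abs_mul, abs_of_nonneg (pow_nonneg hz.1 n), Nat.abs_cast, pow_one]
  have : 0 ≤ (n : ℝ) * z ^ n := mul_nonneg (Nat.cast_nonneg _) (pow_nonneg hz.1 n)
  nlinarith [hb n]

/-- Termwise differentiation on (0, ρ) with z < ρ < 1. Writing the derivative through the Euler
operator z d/dz avoids an index shift. -/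
theorem hasDerivAt_powerSum {c : ℕ → ℝ} (hc : Summable fun n => |c n|) {z : ℝ}
    (hz : z ∈ Set.Ioo (0 : ℝ) 1) :
    HasDerivAt (powerSum c) (powerSum (fun n => n * c n) z / z) z := by
  obtain ⟨ρ, hzρ, hρ1⟩ := exists_between hz.2
  have hρ0 : 0 < ρ := hz.1.trans hzρ
  have hu : Summable fun n : ℕ => |n * c n * ρ ^ n| / ρ :=
    (summable_natCast_mul_mul_pow hc ⟨hρ0.le, hρ1⟩).abs.div_const ρ
  have hder (n : ℕ) (y : ℝ) :
      HasDerivAt (fun y => c n * y ^ n) (c n * (n * y ^ (n - 1))) y :=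
    (hasDerivAt_pow n y).const_mul (c n)
  have h := hasDerivAt_tsum_of_isPreconnected (g := fun n y => c n * y ^ n) (y₀ := z) (y := z)
    (t := Set.Ioo 0 ρ) hu isOpen_Ioo isPreconnected_Ioo (fun n y _ => hder n y)
    (fun n y hy => ?_) ⟨hz.1, hzρ⟩ (summable_mul_pow hc ⟨hz.1.le, hz.2.le⟩) ⟨hz.1, hzρ⟩
  · convert! h using 1
    rw [powerSum, ← tsum_div_const]
    refine tsum_congr fun n => ?_
    cases n with
    | zero => simp
    | succ n =>
      have := hz.1.ne'
      rw [Nat.add_sub_cancel, pow_succ]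
      field_simp
  · cases n with
    | zero => simp
    | succ n =>
      rw [Nat.add_sub_cancel, pow_succ ρ, Real.norm_eq_abs, ← mul_assoc, abs_mul (c (n + 1) * _),
        ← mul_assoc, abs_mul (_ * _) ρ, abs_of_pos hρ0, mul_div_cancel_right₀ _ hρ0.ne',
        abs_mul (_ * _) (ρ ^ n), mul_comm (c (n + 1))]
      exact mul_le_mul_of_nonneg_left
        (by simpa [abs_of_pos hy.1, abs_of_pos hρ0] using pow_le_pow_left₀ hy.1.le hy.2.le n)
        (abs_nonneg _)

/-- The sum of the series `∑ c n * v ^ (-b - n)`. -/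
noncomputable def invPowerSum (b : ℝ) (c : ℕ → ℝ) (v : ℝ) : ℝ := v ^ (-b) * powerSum c v⁻¹

theorem invPowerSum_one (b : ℝ) (c : ℕ → ℝ) : invPowerSum b c 1 = ∑' n, c n := by
  simp [invPowerSum, powerSum]

theorem inv_mem_Icc {v : ℝ} (hv : 1 ≤ v) : v⁻¹ ∈ Set.Icc (0 : ℝ) 1 :=
  ⟨inv_nonneg.2 (zero_le_one.trans hv), inv_le_one_of_one_le₀ hv⟩

theorem inv_mem_Ioo {v : ℝ} (hv : 1 < v) : v⁻¹ ∈ Set.Ioo (0 : ℝ) 1 :=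
  ⟨inv_pos.2 (zero_lt_one.trans hv), inv_lt_one_of_one_lt₀ hv⟩

theorem abs_invPowerSum_le {b : ℝ} {c : ℕ → ℝ} (hc : Summable fun n => |c n|) {v : ℝ}
    (hv : 1 ≤ v) : |invPowerSum b c v| ≤ v ^ (-b) * ∑' n, |c n| := by
  have h0 : 0 ≤ v ^ (-b) := Real.rpow_nonneg (zero_le_one.trans hv) _
  rw [invPowerSum, abs_mul, abs_of_nonneg h0]
  exact mul_le_mul_of_nonneg_left (abs_powerSum_le hc (inv_mem_Icc hv)) h0

theorem abs_invPowerSum_le_tsum {b : ℝ} (hb : 0 ≤ b) {c : ℕ → ℝ} (hc : Summable fun n => |c n|)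
    {v : ℝ} (hv : 1 ≤ v) : |invPowerSum b c v| ≤ ∑' n, |c n| := by
  refine (abs_invPowerSum_le hc hv).trans (mul_le_of_le_one_left ?_ ?_)
  · exact tsum_nonneg fun _ => abs_nonneg _
  · exact Real.rpow_le_one_of_one_le_of_nonpos hv (by linarith)

theorem continuousOn_invPowerSum {b : ℝ} {c : ℕ → ℝ} (hc : Summable fun n => |c n|) :
    ContinuousOn (invPowerSum b c) (Set.Ici 1) := by
  have h1 : ContinuousOn (fun v : ℝ => v⁻¹) (Set.Ici 1) :=
    continuousOn_id.inv₀ fun v hv => (zero_lt_one.trans_le hv).ne'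
  have h2 : ContinuousOn (fun v : ℝ => v ^ (-b)) (Set.Ici 1) :=
    continuousOn_id.rpow_const fun v hv => Or.inl (zero_lt_one.trans_le hv).ne'
  exact h2.mul ((continuousOn_powerSum hc).comp h1 fun v hv => inv_mem_Icc hv)

theorem hasDerivAt_invPowerSum {b : ℝ} {c : ℕ → ℝ} (hc : Summable fun n => |c n|) {v : ℝ}
    (hv : 1 < v) :
    HasDerivAt (invPowerSum b c) (-invPowerSum b (fun n => (b + n) * c n) v / v) v := by
  have hv0 : 0 < v := zero_lt_one.trans hv
  have h1 : HasDerivAt (fun v : ℝ => v ^ (-b)) (-b * v ^ (-b - 1)) v :=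
    Real.hasDerivAt_rpow_const (Or.inl hv0.ne')
  have h2 := (hasDerivAt_powerSum hc (inv_mem_Ioo hv)).comp v (hasDerivAt_inv hv0.ne')
  have h3 : powerSum (fun n : ℕ => (b + n) * c n) v⁻¹ =
      b * powerSum c v⁻¹ + powerSum (fun n : ℕ => n * c n) v⁻¹ := by
    have hi := inv_mem_Ioo hv
    simp only [powerSum]
    rw [← tsum_mul_left, ← ((summable_mul_pow hc ⟨hi.1.le, hi.2.le⟩).mul_left b).tsum_add
      (summable_natCast_mul_mul_pow hc ⟨hi.1.le, hi.2⟩)]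
    exact tsum_congr fun n => by ring
  convert! h1.mul h2 using 1
  rw [invPowerSum, h3, Real.rpow_sub_one hv0.ne']
  simp only [Function.comp]
  field_simp
  ring

/-! ### The two halves of the renewal equation: growth and loss -/

section Renewal

variable {lam δ r α b : ℝ} {c : ℕ → ℝ}

/-- The growth equation lam G = (lam + δ) F - r (v - 1) F' in the variable z = 1 / v. -/
theorem mul_powerSum_shiftedCoefficient (hlam : 0 < lam)
    (hc : Summable fun n => |c n|) {z : ℝ} (hz : z ∈ Set.Ico (0 : ℝ) 1) :
    lam * powerSum (shiftedCoefficient lam δ r b c) z =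
      (lam + δ) * powerSum c z + r * (1 - z) * powerSum (fun n : ℕ => (b + n) * c n) z := by
  have hs1 := summable_mul_pow hc ⟨hz.1, hz.2.le⟩
  have hs2 : Summable fun n : ℕ => (b + n) * c n * z ^ n :=
    ((hs1.mul_left b).add (summable_natCast_mul_mul_pow hc hz)).congr fun n => by ring
  -- The terms of z * ∑ (b + m) c m z ^ m, moved up by one index to match `shiftedCoefficient`.
  let k : ℕ → ℝ := fun n => Nat.casesOn n 0 fun m => z * ((b + m) * c m * z ^ m)
  have hk : HasSum k (z * powerSum (fun n : ℕ => (b + n) * c n) z) := by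
    have h := hasSum_nat_add_iff (f := k) 1 (g := z * powerSum (fun n : ℕ => (b + n) * c n) z)
    rw [Finset.sum_range_one, show k 0 = 0 from rfl, add_zero] at h
    exact h.1 (hs2.hasSum.mul_left z)
  have he : HasSum (fun n => lam * (shiftedCoefficient lam δ r b c n * z ^ n))
      ((lam + δ) * powerSum c z + r * (powerSum (fun n : ℕ => (b + n) * c n) z -
        z * powerSum (fun n : ℕ => (b + n) * c n) z)) := by
    refine ((hs1.hasSum.mul_left (lam + δ)).add ((hs2.hasSum.sub hk).mul_left r)).congr_fun
      fun n => ?_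
    cases n with
    | zero =>
      rw [show k 0 = 0 from rfl]
      simp only [shiftedCoefficient]
      field_simp
      push_cast
      ring
    | succ n =>
      simp only [shiftedCoefficient, k]
      field_simp
      ring
  have h := he.tsum_eq
  rw [tsum_mul_left] at h
  rw [powerSum, h]
  ring

/-- The loss equation α G + v G' = α F in the variable z = 1 / v. -/
theorem mul_powerSum_shiftedCoefficient_sub
    (he : ∀ n : ℕ, shiftedCoefficient lam δ r b c n * (α - b - n) = α * c n)
    (hc' : Summable fun n => |shiftedCoefficient lam δ r b c n|)
    {z : ℝ} (hz : z ∈ Set.Ico (0 : ℝ) 1) :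
    α * powerSum (shiftedCoefficient lam δ r b c) z -
      powerSum (fun n : ℕ => (b + n) * shiftedCoefficient lam δ r b c n) z =
      α * powerSum c z := by
  have hs1 := summable_mul_pow hc' ⟨hz.1, hz.2.le⟩
  have hs2 : Summable fun n : ℕ => (b + n) * shiftedCoefficient lam δ r b c n * z ^ n :=
    ((hs1.mul_left b).add (summable_natCast_mul_mul_pow hc' hz)).congr fun n => by ring
  simp only [powerSum]
  rw [← tsum_mul_left, ← tsum_mul_left, ← (hs1.mul_left α).tsum_sub hs2]
  refine tsum_congr fun n => ?_
  rw [← mul_assoc α (c n), ← he n]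
  ring

/-- By the loss equation, z ^ α * G(v z) is an antiderivative of the integrand. The range z ≥ 1 / v
consists of the losses that do not trap. -/
theorem integral_rpow_mul_invPowerSum
    (he : ∀ n : ℕ, shiftedCoefficient lam δ r b c n * (α - b - n) = α * c n)
    (hc : Summable fun n => |c n|) (hc' : Summable fun n => |shiftedCoefficient lam δ r b c n|)
    {v : ℝ} (hv : 1 ≤ v) :
    ∫ z in v⁻¹..1, α * z ^ (α - 1) * invPowerSum b c (v * z) =
      invPowerSum b (shiftedCoefficient lam δ r b c) v -
        (v⁻¹) ^ α * invPowerSum b (shiftedCoefficient lam δ r b c) 1 := by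
  have hv0 : 0 < v := zero_lt_one.trans_le hv
  have hvi : 0 < v⁻¹ := inv_pos.2 hv0
  have hmaps : Set.MapsTo (fun z => v * z) (Set.Icc v⁻¹ 1) (Set.Ici 1) := fun z hz => by
    simpa [hv0.ne'] using mul_le_mul_of_nonneg_left hz.1 hv0.le
  have hpow (β : ℝ) : ContinuousOn (fun z : ℝ => z ^ β) (Set.Icc v⁻¹ 1) :=
    continuousOn_id.rpow_const fun z hz => Or.inl (hvi.trans_le hz.1).ne'
  have hmul : ContinuousOn (fun z => v * z) (Set.Icc v⁻¹ 1) := by fun_prop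
  have h := intervalIntegral.integral_eq_sub_of_hasDerivAt_of_le
    (f := fun z => z ^ α * invPowerSum b (shiftedCoefficient lam δ r b c) (v * z))
    (f' := fun z => α * z ^ (α - 1) * invPowerSum b c (v * z)) (inv_mem_Icc hv).2
    ((hpow α).mul ((continuousOn_invPowerSum hc').comp hmul hmaps)) (fun z hz => ?_)
    ((((hpow _).const_mul _).mul ((continuousOn_invPowerSum hc).comp hmul
      hmaps)).intervalIntegrable_of_Icc (inv_mem_Icc hv).2)
  · rw [h]
    simp [hv0.ne']
  · have hz0 : 0 < z := hvi.trans hz.1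
    have hvz : 1 < v * z := by simpa [hv0.ne'] using mul_lt_mul_of_pos_left hz.1 hv0
    have hi := inv_mem_Ioo hvz
    have h1 : HasDerivAt (fun z : ℝ => z ^ α) (α * z ^ (α - 1)) z :=
      Real.hasDerivAt_rpow_const (Or.inl hz0.ne')
    have h2 := (hasDerivAt_invPowerSum (b := b) hc' hvz).comp z ((hasDerivAt_id z).const_mul v)
    convert! h1.mul h2 using 1
    have h3 := mul_powerSum_shiftedCoefficient_sub he hc' ⟨hi.1.le, hi.2⟩
    have h4 : z ^ α = z ^ (α - 1) * z := by rw [← Real.rpow_add_one hz0.ne']; simp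
    have hz1 := hz0.ne'
    have hv1 := hv0.ne'
    simp only [invPowerSum, Function.comp, h4]
    calc _ = z ^ (α - 1) * (v * z) ^ (-b) * (α * powerSum c (v * z)⁻¹) := by ring
      _ = _ := by
        rw [← h3]
        field_simp
        ring

/-- The deterministic growth of the relative capital. -/
theorem integral_exp_mul_invPowerSum (hlam : 0 < lam) (hδ : 0 ≤ δ) (hb : 0 ≤ b)
    (hc : Summable fun n => |c n|) (hc' : Summable fun n => |shiftedCoefficient lam δ r b c n|)
    (h1 : ∑' n, shiftedCoefficient lam δ r b c n = (lam + δ) * (∑' n, c n) / lam)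
    {v : ℝ} (hv : 1 ≤ v) :
    ∫ t in Set.Ioi (0 : ℝ), lam * Real.exp (-(lam + δ) * t) *
        invPowerSum b (shiftedCoefficient lam δ r b c) ((v - 1) * Real.exp (r * t) + 1) =
      invPowerSum b c v := by
  have hld : 0 < lam + δ := by linarith
  -- At v = 1 the capital stays put and the series need not be differentiable there; the boundary
  -- identity `h1` replaces the differential equation.
  rcases hv.eq_or_lt with rfl | hv
  · simp only [sub_self, zero_mul, zero_add, invPowerSum_one, h1]
    rw [integral_mul_const, integral_const_mul, integral_exp_mul_Ioi (by linarith), mul_zero,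
      Real.exp_zero, neg_div_neg_eq]
    field_simp
  set g : ℝ → ℝ := fun t => (v - 1) * Real.exp (r * t) + 1 with hg
  have hg1 (t : ℝ) : 1 < g t := by
    have : 0 < (v - 1) * Real.exp (r * t) := mul_pos (by linarith) (Real.exp_pos _)
    simp only [hg]; linarith
  have hgc : Continuous g := by fun_prop
  have hexp : IntegrableOn (fun t => Real.exp (-(lam + δ) * t)) (Set.Ioi 0) :=
    integrableOn_exp_mul_Ioi (by linarith) 0
  -- Along the growth path g' = r (g - 1), so the growth equation makes the integrand an exact
  -- derivative.
  have hder (t : ℝ) : HasDerivAt (fun t => -(Real.exp (-(lam + δ) * t) * invPowerSum b c (g t)))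
      (lam * Real.exp (-(lam + δ) * t) *
        invPowerSum b (shiftedCoefficient lam δ r b c) (g t)) t := by
    have hgd : HasDerivAt g ((v - 1) * (Real.exp (r * t) * (r * 1))) t :=
      ((((hasDerivAt_id t).const_mul r).exp).const_mul (v - 1)).add_const 1
    have he : HasDerivAt (fun t => Real.exp (-(lam + δ) * t))
        (Real.exp (-(lam + δ) * t) * (-(lam + δ) * 1)) t :=
      ((hasDerivAt_id t).const_mul (-(lam + δ))).exp
    have h2 := (he.mul ((hasDerivAt_invPowerSum (b := b) hc (hg1 t)).comp t hgd)).neg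
    convert! h2 using 1
    have hi := inv_mem_Ioo (hg1 t)
    have h3 := mul_powerSum_shiftedCoefficient (δ := δ) (r := r) (b := b) hlam hc ⟨hi.1.le, hi.2⟩
    have hgr : (v - 1) * Real.exp (r * t) = g t - 1 := by simp [hg]
    have hgt : g t ≠ 0 := (zero_lt_one.trans (hg1 t)).ne'
    simp only [Function.comp, invPowerSum]
    calc _ = Real.exp (-(lam + δ) * t) * (g t) ^ (-b) *
          (lam * powerSum (shiftedCoefficient lam δ r b c) (g t)⁻¹) := by ring
      _ = _ := by
        rw [h3, show (v - 1) * (Real.exp (r * t) * (r * 1)) = r * (g t - 1) by rw [← hgr]; ring]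
        field_simp
        ring
  have hcont : Continuous fun t => invPowerSum b (shiftedCoefficient lam δ r b c) (g t) :=
    (continuousOn_invPowerSum hc').comp_continuous hgc fun t => (hg1 t).le
  have hint : IntegrableOn (fun t => lam * Real.exp (-(lam + δ) * t) *
      invPowerSum b (shiftedCoefficient lam δ r b c) (g t)) (Set.Ioi 0) := by
    refine (hexp.const_mul lam).mul_bdd (c := ∑' n, |shiftedCoefficient lam δ r b c n|)
      hcont.aestronglyMeasurable (ae_of_all _ fun t => ?_)
    exact abs_invPowerSum_le_tsum hb hc' (hg1 t).le
  have hlim : Tendsto (fun t => -(Real.exp (-(lam + δ) * t) * invPowerSum b c (g t))) atTop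
      (𝓝 0) := by
    have h0 : Tendsto (fun t => Real.exp (-(lam + δ) * t) * ∑' n, |c n|) atTop (𝓝 0) := by
      have : Tendsto (fun t => Real.exp (-(lam + δ) * t)) atTop (𝓝 0) :=
        Real.tendsto_exp_atBot.comp (tendsto_id.const_mul_atTop_of_neg (by linarith))
      simpa using this.mul_const _
    refine squeeze_zero_norm (fun t => ?_) h0
    rw [norm_neg, Real.norm_eq_abs, abs_mul, Real.abs_exp]
    exact mul_le_mul_of_nonneg_left (abs_invPowerSum_le_tsum hb hc (hg1 t).le) (Real.exp_pos _).le
  rw [integral_Ioi_of_hasDerivAt_of_tendsto' (fun t _ => hder t) hint hlim]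
  simp [hg]

end Renewal

/-! ### The exponential and beta laws -/

theorem integral_betaMeasure_one {α : ℝ} (hα : 0 < α) (f : ℝ → ℝ) :
    ∫ z, f z ∂betaMeasure α 1 = ∫ z in (0 : ℝ)..1, α * z ^ (α - 1) * f z := by
  have hbeta : 1 / beta α 1 = α := by
    rw [beta, Real.Gamma_one, mul_one, Real.Gamma_add_one hα.ne']
    have := (Real.Gamma_pos_of_pos hα).ne'
    field_simp
  have hm : Measurable (betaPDF α 1) := (measurable_betaPDFReal α 1).ennreal_ofReal
  rw [betaMeasure, integral_withDensity_eq_integral_toReal_smul hm (ae_of_all _ fun _ => ENNReal.ofReal_lt_top),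
    intervalIntegral.integral_of_le zero_le_one, integral_Ioc_eq_integral_Ioo,
    ← integral_indicator measurableSet_Ioo]
  congr 1
  ext z
  by_cases hz : z ∈ Set.Ioo (0 : ℝ) 1
  · rw [Set.indicator_of_mem hz, betaPDF_of_pos_lt_one hz.1 hz.2, hbeta, sub_self, Real.rpow_zero,
      mul_one, ENNReal.toReal_ofReal (mul_nonneg hα.le (Real.rpow_nonneg hz.1.le _)), smul_eq_mul]
  · rw [Set.indicator_of_notMem hz, betaPDF_eq, if_neg (show ¬(0 < z ∧ z < 1) from hz)]
    simp

theorem integral_expMeasure {lam : ℝ} (hlam : 0 < lam) (f : ℝ → ℝ) :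
    ∫ t, f t ∂expMeasure lam = ∫ t in Set.Ioi (0 : ℝ), lam * Real.exp (-lam * t) * f t := by
  have h : expMeasure lam = volume.withDensity (exponentialPDF lam) := rfl
  have hm : Measurable (exponentialPDF lam) := (measurable_exponentialPDFReal lam).ennreal_ofReal
  rw [h, integral_withDensity_eq_integral_toReal_smul hm
    (ae_of_all _ fun _ => ENNReal.ofReal_lt_top), ← integral_Ici_eq_integral_Ioi,
    ← integral_indicator measurableSet_Ici]
  congr 1
  ext t
  by_cases ht : t ∈ Set.Ici (0 : ℝ)
  · rw [Set.indicator_of_mem ht, exponentialPDF_of_nonneg ht,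
      ENNReal.toReal_ofReal (by positivity), smul_eq_mul, neg_mul]
  · rw [Set.indicator_of_notMem ht, exponentialPDF_of_neg (not_le.1 ht)]
    simp

theorem expMeasure_Iio_zero (lam : ℝ) : expMeasure lam (Set.Iio 0) = 0 := by
  have h : expMeasure lam = volume.withDensity (exponentialPDF lam) := rfl
  rw [h, withDensity_apply _ measurableSet_Iio]
  exact setLIntegral_eq_zero measurableSet_Iio fun x hx => exponentialPDF_of_neg hx

theorem ae_pos_expMeasure (lam : ℝ) : ∀ᵐ t ∂expMeasure lam, 0 < t := by
  have h : expMeasure lam = volume.withDensity (exponentialPDF lam) := rfl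
  have h1 : ∀ᵐ t ∂expMeasure lam, ¬ t ∈ Set.Iio (0 : ℝ) :=
    measure_eq_zero_iff_ae_notMem.1 (expMeasure_Iio_zero lam)
  have h2 : ∀ᵐ t ∂expMeasure lam, t ∉ ({0} : Set ℝ) := by
    refine measure_eq_zero_iff_ae_notMem.1 ?_
    rw [h]
    exact withDensity_absolutelyContinuous _ _ (measure_singleton 0)
  filter_upwards [h1, h2] with t h3 h4
  exact lt_of_le_of_ne (not_lt.1 h3) fun h => h4 h.symm

theorem ae_mem_Ioo_betaMeasure (α β : ℝ) : ∀ᵐ z ∂betaMeasure α β, z ∈ Set.Ioo (0 : ℝ) 1 := by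
  have h : betaMeasure α β (Set.Ioo (0 : ℝ) 1)ᶜ = 0 := by
    rw [betaMeasure, withDensity_apply _ measurableSet_Ioo.compl]
    refine setLIntegral_eq_zero measurableSet_Ioo.compl fun x hx => ?_
    rw [betaPDF_eq, if_neg (show ¬(0 < x ∧ x < 1) from hx)]
    simp
  exact (measure_eq_zero_iff_ae_notMem.1 h).mono fun z hz => by simpa using hz

/-! ### Value functions on all capitals and the full renewal equation -/

/-- The value function that corresponds to `h`, with the value `κ` below the critical capital. -/
noncomputable def extendBelow (xs κ : ℝ) (h : ℝ → ℝ) (x : ℝ) : ℝ :=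
  if x < xs then κ else h (x / xs)

theorem extendBelow_of_lt {xs κ : ℝ} {h : ℝ → ℝ} {x : ℝ} (hx : x < xs) :
    extendBelow xs κ h x = κ := if_pos hx

theorem extendBelow_of_le {xs κ : ℝ} {h : ℝ → ℝ} {x : ℝ} (hx : xs ≤ x) :
    extendBelow xs κ h x = h (x / xs) := if_neg hx.not_gt

theorem measurable_extendBelow {xs κ : ℝ} (hxs : 0 < xs) {h : ℝ → ℝ}
    (hh : ContinuousOn h (Set.Ici 1)) : Measurable (extendBelow xs κ h) := by
  have hc : ContinuousOn (fun x => h (x / xs)) (Set.Ici xs) :=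
    hh.comp (continuous_id.div_const xs).continuousOn fun x hx => by
      simpa [one_le_div hxs] using hx
  have h0 : extendBelow xs κ h =
      (Set.Ici xs).piecewise (fun x => h (x / xs)) fun _ => κ := by
    ext x
    by_cases hx : x < xs
    · rw [extendBelow_of_lt hx, Set.piecewise_eq_of_notMem _ _ _ (by simpa using hx)]
    · rw [extendBelow_of_le (not_lt.1 hx), Set.piecewise_eq_of_mem _ _ _ (by simpa using hx)]
  rw [h0]
  exact hc.measurable_piecewise continuousOn_const measurableSet_Ici

theorem abs_extendBelow_le {xs κ C : ℝ} (hxs : 0 < xs) {h : ℝ → ℝ}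
    (hh : ∀ v, 1 ≤ v → |h v| ≤ C) (x : ℝ) : |extendBelow xs κ h x| ≤ max |κ| C := by
  rcases lt_or_ge x xs with hx | hx
  · rw [extendBelow_of_lt hx]; exact le_max_left _ _
  · rw [extendBelow_of_le hx]
    exact (hh _ ((one_le_div hxs).2 hx)).trans (le_max_right _ _)

theorem grow_of_le {r xs s u : ℝ} (hu : xs ≤ u) :
    Household.grow r xs s u = (u - xs) * Real.exp (r * s) + xs := by
  rcases hu.eq_or_lt with rfl | hu
  · simp [Household.grow]
  · simp [Household.grow, hu]

theorem le_grow {r xs s u : ℝ} (hu : xs ≤ u) : xs ≤ Household.grow r xs s u := by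
  rw [grow_of_le hu]
  have : 0 ≤ (u - xs) * Real.exp (r * s) := mul_nonneg (by linarith) (Real.exp_pos _).le
  linarith

theorem measurable_grow (r xs : ℝ) :
    Measurable fun p : ℝ × ℝ => Household.grow r xs p.1 p.2 := by
  unfold Household.grow
  exact Measurable.ite (measurableSet_lt measurable_const measurable_snd) (by fun_prop)
    measurable_snd

section Renewal

variable {lam δ r α b xs : ℝ} {c : ℕ → ℝ}

/-- Trapping losses z < 1 / v contribute κ * v ^ (-α). Since κ = G(1), this cancels exactly the
lower boundary term in `integral_rpow_mul_invPowerSum`. -/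
theorem integral_betaMeasure_extendBelow (hα : 0 < α) (hxs : 0 < xs)
    (he : ∀ n : ℕ, shiftedCoefficient lam δ r b c n * (α - b - n) = α * c n)
    (hc : Summable fun n => |c n|) (hc' : Summable fun n => |shiftedCoefficient lam δ r b c n|)
    {y : ℝ} (hy : xs ≤ y) :
    ∫ z, extendBelow xs (∑' n, shiftedCoefficient lam δ r b c n) (invPowerSum b c) (y * z)
        ∂betaMeasure α 1 =
      invPowerSum b (shiftedCoefficient lam δ r b c) (y / xs) := by
  set v := y / xs with hv
  have hyv : y = v * xs := by rw [hv, div_mul_cancel₀ _ hxs.ne']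
  have hv1 : 1 ≤ v := (one_le_div hxs).2 hy
  have hv0 : 0 < v := zero_lt_one.trans_le hv1
  have hvi := inv_mem_Icc hv1
  set κ := ∑' n, shiftedCoefficient lam δ r b c n with hκ
  have hmaps : Set.MapsTo (fun z => v * z) (Set.Icc v⁻¹ 1) (Set.Ici 1) := fun z hz => by
    simpa [hv0.ne'] using mul_le_mul_of_nonneg_left hz.1 hv0.le
  have hE1 : Set.EqOn (fun z => α * z ^ (α - 1) * κ)
      (fun z => α * z ^ (α - 1) * extendBelow xs κ (invPowerSum b c) (y * z))
      (Set.uIoo 0 v⁻¹) := fun z hz => by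
    rw [Set.uIoo_of_le hvi.1] at hz
    have : y * z < xs := by
      have : v * z < 1 := by simpa [hv0.ne'] using mul_lt_mul_of_pos_left hz.2 hv0
      rw [hyv]; nlinarith
    simp only [extendBelow_of_lt this]
  have hE2 : Set.EqOn (fun z => α * z ^ (α - 1) * invPowerSum b c (v * z))
      (fun z => α * z ^ (α - 1) * extendBelow xs κ (invPowerSum b c) (y * z))
      (Set.uIoo v⁻¹ 1) := fun z hz => by
    rw [Set.uIoo_of_le hvi.2] at hz
    have : xs ≤ y * z := by
      have := hmaps ⟨hz.1.le, hz.2.le⟩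
      simp only [Set.mem_Ici] at this
      rw [hyv]; nlinarith
    have h2 : y * z / xs = v * z := by rw [hv]; ring
    simp only [extendBelow_of_le this, h2]
  have hI1 : IntervalIntegrable (fun z : ℝ => α * z ^ (α - 1) * κ) volume 0 v⁻¹ :=
    ((intervalIntegral.intervalIntegrable_rpow' (by linarith)).const_mul α).mul_const κ
  have hI2 : IntervalIntegrable (fun z : ℝ => α * z ^ (α - 1) * invPowerSum b c (v * z))
      volume v⁻¹ 1 := by
    refine ContinuousOn.intervalIntegrable_of_Icc hvi.2 (ContinuousOn.mul ?_ ?_)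
    · exact (continuousOn_id.rpow_const fun z hz =>
        Or.inl ((inv_pos.2 hv0).trans_le hz.1).ne').const_mul α |>.congr fun z _ => rfl
    · exact (continuousOn_invPowerSum hc).comp (by fun_prop) hmaps
  rw [integral_betaMeasure_one hα, ← intervalIntegral.integral_add_adjacent_intervals
    (hI1.congr_uIoo hE1) (hI2.congr_uIoo hE2),
    ← intervalIntegral.integral_congr_uIoo hE1, ← intervalIntegral.integral_congr_uIoo hE2,
    integral_rpow_mul_invPowerSum he hc hc' hv1, invPowerSum_one, ← hκ,
    intervalIntegral.integral_mul_const, intervalIntegral.integral_const_mul,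
    integral_rpow (Or.inl (by linarith))]
  rw [sub_add_cancel, Real.zero_rpow hα.ne']
  field_simp
  ring

/-- The renewal equation of the value function, by conditioning on the first event. -/
theorem integral_prod_extendBelow (hlam : 0 < lam) (hδ : 0 ≤ δ) (hb : 0 ≤ b)
    (hα : 0 < α) (hxs : 0 < xs)
    (he : ∀ n : ℕ, shiftedCoefficient lam δ r b c n * (α - b - n) = α * c n)
    (hc : Summable fun n => |c n|) (hc' : Summable fun n => |shiftedCoefficient lam δ r b c n|)
    (h1 : ∑' n, shiftedCoefficient lam δ r b c n = (lam + δ) * (∑' n, c n) / lam)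
    {x : ℝ} (hx : xs ≤ x) :
    Integrable (fun p : ℝ × ℝ => Real.exp (-δ * p.1) *
        extendBelow xs (∑' n, shiftedCoefficient lam δ r b c n) (invPowerSum b c)
          (Household.grow r xs p.1 x * p.2)) ((expMeasure lam).prod (betaMeasure α 1)) ∧
    ∫ p : ℝ × ℝ, Real.exp (-δ * p.1) *
        extendBelow xs (∑' n, shiftedCoefficient lam δ r b c n) (invPowerSum b c)
          (Household.grow r xs p.1 x * p.2) ∂(expMeasure lam).prod (betaMeasure α 1) =
      invPowerSum b c (x / xs) := by
  have := isProbabilityMeasure_expMeasure hlam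
  have := isProbabilityMeasureBeta hα zero_lt_one
  set κ := ∑' n, shiftedCoefficient lam δ r b c n with hκ
  have hm := measurable_extendBelow (κ := κ) hxs (continuousOn_invPowerSum (b := b) hc)
  have hbd := abs_extendBelow_le (κ := κ) hxs fun v hv => abs_invPowerSum_le_tsum hb hc hv
  have hmY : Measurable fun p : ℝ × ℝ => Household.grow r xs p.1 x * p.2 :=
    ((measurable_grow r xs).comp (measurable_fst.prodMk measurable_const)).mul measurable_snd
  have hpos : ∀ᵐ p ∂(expMeasure lam).prod (betaMeasure α 1), 0 < p.1 :=
    Measure.quasiMeasurePreserving_fst.ae (ae_pos_expMeasure lam)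
  have hint : Integrable (fun p : ℝ × ℝ => Real.exp (-δ * p.1) *
      extendBelow xs κ (invPowerSum b c) (Household.grow r xs p.1 x * p.2))
      ((expMeasure lam).prod (betaMeasure α 1)) := by
    refine Integrable.of_bound (C := max |κ| (∑' n, |c n|)) ?_ ?_
    · exact ((by fun_prop : Measurable fun p : ℝ × ℝ => Real.exp (-δ * p.1)).mul
        (hm.comp hmY)).aestronglyMeasurable
    · filter_upwards [hpos] with p hp
      rw [Real.norm_eq_abs, abs_mul, Real.abs_exp]
      have h2 : Real.exp (-δ * p.1) ≤ 1 := by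
        rw [Real.exp_le_one_iff]; nlinarith
      calc _ ≤ 1 * |extendBelow xs κ (invPowerSum b c) (Household.grow r xs p.1 x * p.2)| :=
            mul_le_mul_of_nonneg_right h2 (abs_nonneg _)
        _ ≤ _ := by rw [one_mul]; exact hbd _
  refine ⟨hint, ?_⟩
  rw [integral_prod _ hint]
  have hin (t : ℝ) : ∫ z, Real.exp (-δ * t) *
      extendBelow xs κ (invPowerSum b c) (Household.grow r xs t x * z) ∂betaMeasure α 1 =
      Real.exp (-δ * t) * invPowerSum b (shiftedCoefficient lam δ r b c)
        (Household.grow r xs t x / xs) := by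
    rw [integral_const_mul, integral_betaMeasure_extendBelow hα hxs he hc hc' (le_grow hx)]
  simp only [hin]
  rw [integral_expMeasure hlam, ← integral_exp_mul_invPowerSum hlam hδ hb hc hc' h1
    ((one_le_div hxs).2 hx) (r := r)]
  congr 1
  ext t
  rw [grow_of_le hx, neg_add, add_mul, Real.exp_add]
  have : ((x - xs) * Real.exp (r * t) + xs) / xs = (x / xs - 1) * Real.exp (r * t) + 1 := by
    field_simp
  rw [this]
  ring

end Renewal

/-! ### The transition operator of the capital at event times -/

/-- The joint law of an inter-arrival time and of the proportion that remains after the loss. -/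
noncomputable def stepLaw (lam α : ℝ) : Measure (ℝ × ℝ) :=
  (expMeasure lam).prod (betaMeasure α 1)

theorem isProbabilityMeasure_stepLaw {lam α : ℝ} (hlam : 0 < lam) (hα : 0 < α) :
    IsProbabilityMeasure (stepLaw lam α) := by
  have := isProbabilityMeasure_expMeasure hlam
  have := isProbabilityMeasureBeta hα zero_lt_one
  unfold stepLaw
  infer_instance

theorem ae_stepLaw {lam α : ℝ} (hlam : 0 < lam) (hα : 0 < α) :
    ∀ᵐ p ∂stepLaw lam α, 0 < p.1 ∧ 0 < p.2 := by
  have := isProbabilityMeasure_expMeasure hlam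
  have := isProbabilityMeasureBeta hα zero_lt_one
  have h1 : ∀ᵐ p ∂(expMeasure lam).prod (betaMeasure α 1), 0 < p.1 :=
    Measure.quasiMeasurePreserving_fst.ae (ae_pos_expMeasure lam)
  have h2 : ∀ᵐ p ∂(expMeasure lam).prod (betaMeasure α 1), p.2 ∈ Set.Ioo (0 : ℝ) 1 :=
    Measure.quasiMeasurePreserving_snd.ae (ae_mem_Ioo_betaMeasure α 1)
  filter_upwards [h1, h2] with p hp1 hp2 using ⟨hp1, hp2.1⟩

/-- The discounted expectation of `g` at the capital after the next event. -/
noncomputable def discountedNext (r xs δ : ℝ) (μ : Measure (ℝ × ℝ)) (g : ℝ → ℝ≥0∞) (x : ℝ) :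
    ℝ≥0∞ :=
  ∫⁻ p, ENNReal.ofReal (Real.exp (-δ * p.1)) * g (Household.grow r xs p.1 x * p.2) ∂μ

/-- One step of the capital chain that is stopped when it falls below `xs`. -/
noncomputable def stoppedNext (r xs δ : ℝ) (μ : Measure (ℝ × ℝ)) (g : ℝ → ℝ≥0∞) (x : ℝ) :
    ℝ≥0∞ :=
  if x < xs then g x else discountedNext r xs δ μ g x

section Operator

variable {r xs δ : ℝ} {μ : Measure (ℝ × ℝ)}

theorem measurable_grow_mul (r xs : ℝ) :
    Measurable fun q : ℝ × (ℝ × ℝ) => Household.grow r xs q.2.1 q.1 * q.2.2 :=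
  ((measurable_grow r xs).comp (by fun_prop : Measurable fun q : ℝ × (ℝ × ℝ) => (q.2.1, q.1))).mul
    (by fun_prop)

theorem measurable_discountedNext_integrand {g : ℝ → ℝ≥0∞} (hg : Measurable g) :
    Measurable fun q : ℝ × (ℝ × ℝ) => ENNReal.ofReal (Real.exp (-δ * q.2.1)) *
      g (Household.grow r xs q.2.1 q.1 * q.2.2) :=
  (by fun_prop : Measurable fun q : ℝ × (ℝ × ℝ) => ENNReal.ofReal (Real.exp (-δ * q.2.1))).mul
    (hg.comp (measurable_grow_mul r xs))

theorem measurable_discountedNext_integrand_right {g : ℝ → ℝ≥0∞} (hg : Measurable g) (x : ℝ) :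
    Measurable fun p : ℝ × ℝ => ENNReal.ofReal (Real.exp (-δ * p.1)) *
      g (Household.grow r xs p.1 x * p.2) :=
  (measurable_discountedNext_integrand hg).comp measurable_prodMk_left

theorem measurable_discountedNext [SFinite μ] {g : ℝ → ℝ≥0∞} (hg : Measurable g) :
    Measurable (discountedNext r xs δ μ g) :=
  (measurable_discountedNext_integrand hg).lintegral_prod_right'

theorem measurable_stoppedNext [SFinite μ] {g : ℝ → ℝ≥0∞} (hg : Measurable g) :
    Measurable (stoppedNext r xs δ μ g) :=
  Measurable.ite measurableSet_Iio hg (measurable_discountedNext hg)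

theorem discountedNext_mono {f g : ℝ → ℝ≥0∞} (h : ∀ x, f x ≤ g x) (x : ℝ) :
    discountedNext r xs δ μ f x ≤ discountedNext r xs δ μ g x :=
  lintegral_mono fun _ => mul_le_mul_right (h _) _

theorem stoppedNext_mono {f g : ℝ → ℝ≥0∞} (h : ∀ x, f x ≤ g x) (x : ℝ) :
    stoppedNext r xs δ μ f x ≤ stoppedNext r xs δ μ g x := by
  unfold stoppedNext
  split_ifs
  · exact h x
  · exact discountedNext_mono h x

/-- Subtraction in `ℝ≥0∞` is truncated, so only an inequality holds; it has the direction that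
subsolutions need. -/
theorem discountedNext_sub_le {f g : ℝ → ℝ≥0∞} (hf : Measurable f) (x : ℝ) :
    discountedNext r xs δ μ g x - discountedNext r xs δ μ f x ≤
      discountedNext r xs δ μ (fun y => g y - f y) x := by
  refine (lintegral_sub_le _ _ (measurable_discountedNext_integrand_right hf x)).trans_eq ?_
  refine lintegral_congr fun p => ?_
  rw [ENNReal.mul_sub fun _ _ => ENNReal.ofReal_ne_top]

theorem discountedNext_const_mul {g : ℝ → ℝ≥0∞} (hg : Measurable g) (C : ℝ≥0∞) (x : ℝ) :
    discountedNext r xs δ μ (fun y => C * g y) x = C * discountedNext r xs δ μ g x := by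
  unfold discountedNext
  rw [← lintegral_const_mul _ (measurable_discountedNext_integrand_right hg x)]
  exact lintegral_congr fun p => by ring

theorem discountedNext_iSup {g : ℕ → ℝ → ℝ≥0∞} (hg : ∀ n, Measurable (g n))
    (hmono : Monotone g) (x : ℝ) :
    discountedNext r xs δ μ (fun y => ⨆ n, g n y) x = ⨆ n, discountedNext r xs δ μ (g n) x := by
  unfold discountedNext
  rw [← lintegral_iSup (fun n => measurable_discountedNext_integrand_right (hg n) x)]
  · exact lintegral_congr fun p => by rw [ENNReal.mul_iSup]
  · exact fun m n hmn p => mul_le_mul_right (hmono hmn _) _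

end Operator

/-! ### The maximum principle -/

theorem expMeasure_Ioo_ne_zero {lam : ℝ} (hlam : 0 < lam) {s t : ℝ} (hs : 0 ≤ s) (hst : s < t) :
    expMeasure lam (Set.Ioo s t) ≠ 0 := by
  have h : expMeasure lam = volume.withDensity (exponentialPDF lam) := rfl
  have hm : Measurable (exponentialPDF lam) := (measurable_exponentialPDFReal lam).ennreal_ofReal
  rw [h, Ne, withDensity_apply_eq_zero hm]
  have hsub : Set.Ioo s t ⊆ {t | exponentialPDF lam t ≠ 0} ∩ Set.Ioo s t := fun u hu =>
    ⟨by simpa [exponentialPDF] using exponentialPDFReal_pos hlam (hs.trans_lt hu.1), hu⟩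
  intro h0
  have := measure_mono_null hsub h0
  simp at this
  linarith

theorem betaMeasure_Ioo_ne_zero {α w : ℝ} (hα : 0 < α) (hw : 0 < w) :
    betaMeasure α 1 (Set.Ioo 0 w) ≠ 0 := by
  have hm : Measurable (betaPDF α 1) := (measurable_betaPDFReal α 1).ennreal_ofReal
  rw [betaMeasure, Ne, withDensity_apply_eq_zero hm]
  have hsub : Set.Ioo (0 : ℝ) (min w 1) ⊆ {t | betaPDF α 1 t ≠ 0} ∩ Set.Ioo 0 w := fun t ht =>
    ⟨by simpa [betaPDF] using
      betaPDFReal_pos ht.1 (ht.2.trans_le (min_le_right _ _)) hα zero_lt_one,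
      ht.1, ht.2.trans_le (min_le_left _ _)⟩
  intro h0
  have := measure_mono_null hsub h0
  simp at this
  linarith

/-- With positive probability the wait is below 1 and the remaining proportion is below xs divided
by the capital grown for time 1, which traps. -/
theorem stepLaw_survival_lt_one {lam α r xs R : ℝ} (hlam : 0 < lam) (hα : 0 < α) (hr : 0 < r)
    (hxs : 0 < xs) (hR : xs ≤ R) :
    stepLaw lam α {p | xs ≤ Household.grow r xs p.1 R * p.2} < 1 := by
  have := isProbabilityMeasure_expMeasure hlam
  have := isProbabilityMeasureBeta hα zero_lt_one
  have := isProbabilityMeasure_stepLaw hlam hα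
  have hG : 0 < Household.grow r xs 1 R := hxs.trans_le (le_grow hR)
  have hmeas : MeasurableSet {p : ℝ × ℝ | xs ≤ Household.grow r xs p.1 R * p.2} :=
    measurableSet_le measurable_const ((measurable_grow_mul r xs).comp measurable_prodMk_left)
  rw [lt_iff_le_and_ne]
  refine ⟨prob_le_one, fun h1 => ?_⟩
  rw [← prob_compl_eq_zero_iff hmeas] at h1
  have hsub : Set.Ioo (0 : ℝ) 1 ×ˢ Set.Ioo 0 (xs / Household.grow r xs 1 R) ⊆
      {p : ℝ × ℝ | xs ≤ Household.grow r xs p.1 R * p.2}ᶜ := by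
    rintro ⟨s, z⟩ ⟨hs, hz⟩
    have h2 : Household.grow r xs s R ≤ Household.grow r xs 1 R := by
      rw [grow_of_le hR, grow_of_le hR]
      have : Real.exp (r * s) ≤ Real.exp (r * 1) :=
        Real.exp_le_exp.2 (mul_le_mul_of_nonneg_left hs.2.le hr.le)
      nlinarith
    have h3 : Household.grow r xs 1 R * z < xs := by
      rw [mul_comm]; exact (lt_div_iff₀ hG).1 hz.2
    simp only [Set.mem_compl_iff, Set.mem_ofPred_eq, not_le]
    exact (mul_le_mul_of_nonneg_right h2 hz.1.le).trans_lt h3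
  have h4 := measure_mono_null hsub h1
  rw [stepLaw, Measure.prod_prod, mul_eq_zero] at h4
  exact h4.elim (expMeasure_Ioo_ne_zero hlam le_rfl one_pos) (betaMeasure_Ioo_ne_zero hα (div_pos hxs hG))

/-- A maximum principle for subsolutions of the homogeneous renewal equation. -/
theorem eq_zero_of_le_discountedNext {lam α r xs δ : ℝ} (hlam : 0 < lam) (hα : 0 < α)
    (hr : 0 < r) (hxs : 0 < xs) (hδ : 0 ≤ δ) {D : ℝ → ℝ≥0∞} {C : ℝ≥0∞} (hC : C ≠ ∞)
    (hDC : ∀ x, D x ≤ C) (hbelow : ∀ x < xs, D x = 0)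
    (hle : ∀ x, xs ≤ x → D x ≤ discountedNext r xs δ (stepLaw lam α) D x)
    (hlim : ∀ ε : ℝ≥0∞, 0 < ε → ∃ R, ∀ x, R ≤ x → D x ≤ ε) (x : ℝ) : D x = 0 := by
  have hS : ⨆ x, D x ≤ C := iSup_le hDC
  set S := ⨆ x, D x with hSdef
  have hStop : S ≠ ∞ := (hS.trans_lt hC.lt_top).ne
  suffices S = 0 from nonpos_iff_eq_zero.1 (this ▸ le_iSup D x)
  by_contra hS0
  -- Beyond R, `D` is at most S / 2. Up to R, monotonicity of growth bounds the survival probability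
  -- by q < 1, and only survival contributes. Both bounds lie strictly below the supremum S.
  obtain ⟨R₀, hR₀⟩ := hlim (S / 2) (ENNReal.half_pos hS0)
  set R := max R₀ xs
  set q := stepLaw lam α {p | xs ≤ Household.grow r xs p.1 R * p.2}
  have hq : q < 1 := stepLaw_survival_lt_one hlam hα hr hxs (le_max_right _ _)
  have hmeas : MeasurableSet {p : ℝ × ℝ | xs ≤ Household.grow r xs p.1 R * p.2} :=
    measurableSet_le measurable_const ((measurable_grow_mul r xs).comp measurable_prodMk_left)
  have hbound (y : ℝ) : D y ≤ max (S / 2) (S * q) := by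
    rcases lt_or_ge y xs with hy | hy
    · rw [hbelow y hy]; exact zero_le
    rcases le_total R y with hRy | hRy
    · exact (hR₀ y ((le_max_left _ _).trans hRy)).trans (le_max_left _ _)
    refine ((hle y hy).trans ?_).trans (le_max_right _ _)
    calc discountedNext r xs δ (stepLaw lam α) D y
        ≤ ∫⁻ p, {p : ℝ × ℝ | xs ≤ Household.grow r xs p.1 R * p.2}.indicator (fun _ => S) p
            ∂stepLaw lam α := by
          refine lintegral_mono_ae ?_
          filter_upwards [ae_stepLaw hlam hα] with p hp
          have h1 : ENNReal.ofReal (Real.exp (-δ * p.1)) ≤ 1 := by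
            rw [ENNReal.ofReal_le_one, Real.exp_le_one_iff]
            nlinarith
          rcases lt_or_ge (Household.grow r xs p.1 y * p.2) xs with h2 | h2
          · rw [hbelow _ h2, mul_zero]; exact zero_le
          · have h3 : Household.grow r xs p.1 y ≤ Household.grow r xs p.1 R := by
              rw [grow_of_le hy, grow_of_le (hy.trans hRy)]
              nlinarith [Real.exp_pos (r * p.1)]
            rw [Set.indicator_of_mem (by
              exact h2.trans (mul_le_mul_of_nonneg_right h3 hp.2.le))]
            exact (mul_le_mul' h1 (le_iSup D _)).trans_eq (one_mul _)
      _ = S * q := lintegral_indicator_const hmeas S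
  have h1 : S ≤ max (S / 2) (S * q) := iSup_le hbound
  have h2 : S / 2 < S := ENNReal.half_lt_self hS0 hStop
  have h3 : S * q < S * 1 := ENNReal.mul_lt_mul_right hS0 hStop hq
  rw [mul_one] at h3
  exact absurd h1 (not_le.2 (max_lt h2 h3))

/-! ### The discounted trapping probability as minimal solution -/

/-- The discounted probability of trapping at one of the first `n` events. -/
noncomputable def trappingIter (r xs δ : ℝ) (μ : Measure (ℝ × ℝ)) (n : ℕ) : ℝ → ℝ≥0∞ :=
  (stoppedNext r xs δ μ)^[n] ((Set.Iio xs).indicator 1)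

section Trapping

variable {r xs δ : ℝ} {μ : Measure (ℝ × ℝ)}

theorem trappingIter_zero : trappingIter r xs δ μ 0 = (Set.Iio xs).indicator 1 := rfl

theorem trappingIter_succ (n : ℕ) :
    trappingIter r xs δ μ (n + 1) = stoppedNext r xs δ μ (trappingIter r xs δ μ n) :=
  Function.iterate_succ_apply' _ _ _

theorem measurable_trappingIter [SFinite μ] (n : ℕ) : Measurable (trappingIter r xs δ μ n) := by
  induction n with
  | zero => exact measurable_one.indicator measurableSet_Iio
  | succ n ih => rw [trappingIter_succ]; exact measurable_stoppedNext ih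

theorem trappingIter_of_lt (n : ℕ) {x : ℝ} (hx : x < xs) : trappingIter r xs δ μ n x = 1 := by
  induction n with
  | zero => rw [trappingIter_zero, Set.indicator_of_mem (by exact hx)]; rfl
  | succ n ih => rw [trappingIter_succ, stoppedNext, if_pos hx, ih]

/-- Minimality: the iteration starts below every supersolution, and the monotone operator keeps it
there. -/
theorem trappingIter_le {W : ℝ → ℝ≥0∞} (hbelow : ∀ x < xs, W x = 1)
    (hW : ∀ x, xs ≤ x → discountedNext r xs δ μ W x ≤ W x) (n : ℕ) (x : ℝ) :
    trappingIter r xs δ μ n x ≤ W x := by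
  induction n generalizing x with
  | zero =>
    rw [trappingIter_zero]
    rcases lt_or_ge x xs with hx | hx
    · rw [Set.indicator_of_mem (by exact hx), hbelow x hx]; rfl
    · rw [Set.indicator_of_notMem (by simpa using hx)]; exact zero_le
  | succ n ih =>
    rcases lt_or_ge x xs with hx | hx
    · rw [trappingIter_of_lt _ hx, hbelow x hx]
    · rw [trappingIter_succ, stoppedNext, if_neg hx.not_gt]
      exact (discountedNext_mono ih x).trans (hW x hx)

theorem monotone_trappingIter : Monotone (trappingIter r xs δ μ) := by
  refine monotone_nat_of_le_succ fun n => ?_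
  induction n with
  | zero =>
    intro x
    rcases lt_or_ge x xs with hx | hx
    · rw [trappingIter_of_lt _ hx, trappingIter_of_lt _ hx]
    · rw [trappingIter_zero, Set.indicator_of_notMem (by simpa using hx)]; exact zero_le
  | succ n ih =>
    rw [trappingIter_succ, trappingIter_succ (n + 1)]
    exact fun x => stoppedNext_mono ih x

theorem iSup_trappingIter_eq_discountedNext [SFinite μ] {x : ℝ} (hx : xs ≤ x) :
    ⨆ n, trappingIter r xs δ μ n x =
      discountedNext r xs δ μ (fun y => ⨆ n, trappingIter r xs δ μ n y) x := by
  rw [discountedNext_iSup measurable_trappingIter monotone_trappingIter]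
  refine le_antisymm (iSup_le fun n => ?_) (iSup_le fun n => ?_)
  · refine (monotone_trappingIter n.le_succ x).trans ?_
    rw [trappingIter_succ, stoppedNext, if_neg hx.not_gt]
    exact le_iSup (fun n => discountedNext r xs δ μ (trappingIter r xs δ μ n) x) n
  · refine le_trans (le_of_eq ?_) (le_iSup (fun n => trappingIter r xs δ μ n x) (n + 1))
    rw [trappingIter_succ, stoppedNext, if_neg hx.not_gt]

end Trapping

/-! ### Identification of solutions and the critical logarithm -/

section Identification

variable {lam α r xs δ : ℝ}

/-- The error of a bounded solution of the renewal equation is a subsolution. -/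
theorem sub_iSup_trappingIter_le (hlam : 0 < lam) (hα : 0 < α) {W : ℝ → ℝ≥0∞}
    (hW : ∀ x, xs ≤ x → W x ≤ discountedNext r xs δ (stepLaw lam α) W x) {x : ℝ} (hx : xs ≤ x) :
    W x - ⨆ n, trappingIter r xs δ (stepLaw lam α) n x ≤
      discountedNext r xs δ (stepLaw lam α)
        (fun y => W y - ⨆ n, trappingIter r xs δ (stepLaw lam α) n y) x := by
  have := isProbabilityMeasure_stepLaw hlam hα
  rw [iSup_trappingIter_eq_discountedNext hx]
  exact (tsub_le_tsub_right (hW x hx) _).trans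
    (discountedNext_sub_le (Measurable.iSup measurable_trappingIter) x)

theorem iSup_trappingIter_of_lt {μ : Measure (ℝ × ℝ)} {x : ℝ} (hx : x < xs) :
    ⨆ n, trappingIter r xs δ μ n x = 1 := by
  simp only [trappingIter_of_lt _ hx, ciSup_const]

/-- A bounded solution of the renewal equation that vanishes at infinity is the discounted
trapping probability. -/
theorem iSup_trappingIter_eq_of_vanishing (hlam : 0 < lam) (hα : 0 < α)
    (hr : 0 < r) (hxs : 0 < xs) (hδ : 0 ≤ δ) {W : ℝ → ℝ≥0∞} {C : ℝ≥0∞} (hC : C ≠ ∞)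
    (hWC : ∀ x, W x ≤ C) (hbelow : ∀ x < xs, W x = 1)
    (hW : ∀ x, xs ≤ x → discountedNext r xs δ (stepLaw lam α) W x = W x)
    (hlim : ∀ ε : ℝ≥0∞, 0 < ε → ∃ R, ∀ x, R ≤ x → W x ≤ ε) (x : ℝ) :
    ⨆ n, trappingIter r xs δ (stepLaw lam α) n x = W x := by
  refine le_antisymm (iSup_le fun n => trappingIter_le hbelow (fun x hx => (hW x hx).le) n x) ?_
  refine tsub_eq_zero_iff_le.1 (eq_zero_of_le_discountedNext hlam hα hr hxs hδ hC
    (D := fun x => W x - ⨆ n, trappingIter r xs δ (stepLaw lam α) n x)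
    (fun x => tsub_le_self.trans (hWC x)) (fun x hx => ?_)
    (fun x hx => sub_iSup_trappingIter_le hlam hα (fun x hx => (hW x hx).ge) hx) ?_ x)
  · simp only [iSup_trappingIter_of_lt hx, hbelow x hx, tsub_self]
  · intro ε hε
    obtain ⟨R, hR⟩ := hlim ε hε
    exact ⟨R, fun x hx => tsub_le_self.trans (hR x hx)⟩

/-- The derivative of z ^ α * log (v z) is α z ^ (α - 1) (log (v z) + 1 / α), and the boundary term
at z = 1 / v is zero because log 1 = 0. The constant 1 / α is the mean of -log Z. -/
theorem lintegral_betaMeasure_log (hα : 0 < α) (hxs : 0 < xs) {y : ℝ} (hy : xs ≤ y) :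
    ∫⁻ z, ENNReal.ofReal (extendBelow xs 0 (fun v => Real.log v + 1 / α) (y * z))
      ∂betaMeasure α 1 = ENNReal.ofReal (Real.log (y / xs)) := by
  have := isProbabilityMeasureBeta hα zero_lt_one
  set f := extendBelow xs 0 (fun v => Real.log v + 1 / α) with hf
  set v := y / xs with hv
  have hyv : y = v * xs := by rw [hv, div_mul_cancel₀ _ hxs.ne']
  have hv1 : 1 ≤ v := (one_le_div hxs).2 hy
  have hv0 : 0 < v := zero_lt_one.trans_le hv1
  have hvi := inv_mem_Icc hv1
  have hmaps (z : ℝ) (hz : v⁻¹ ≤ z) : 1 ≤ v * z := by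
    simpa [hv0.ne'] using mul_le_mul_of_nonneg_left hz hv0.le
  have hfm : Measurable f := by
    refine measurable_extendBelow hxs (ContinuousOn.add ?_ continuousOn_const)
    exact Real.continuousOn_log.mono fun v hv => (zero_lt_one.trans_le hv).ne'
  have hf0 (x : ℝ) : 0 ≤ f x := by
    rcases lt_or_ge x xs with hx | hx
    · rw [hf, extendBelow_of_lt hx]
    · rw [hf, extendBelow_of_le hx]
      have := Real.log_nonneg ((one_le_div hxs).2 hx)
      positivity
  have hint : Integrable (fun z => f (y * z)) (betaMeasure α 1) := by
    refine Integrable.of_bound (C := Real.log v + 1 / α)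
      (hfm.comp (by fun_prop)).aestronglyMeasurable ?_
    filter_upwards [ae_mem_Ioo_betaMeasure α 1] with z hz
    rw [Real.norm_eq_abs, abs_of_nonneg (hf0 _)]
    rcases lt_or_ge (y * z) xs with hx | hx
    · rw [hf, extendBelow_of_lt hx]
      have := Real.log_nonneg hv1
      positivity
    · rw [hf, extendBelow_of_le hx]
      have : Real.log (y * z / xs) ≤ Real.log v := by
        have h1 := (one_le_div hxs).2 hx
        refine Real.log_le_log (by linarith) ?_
        rw [hv]
        gcongr
        nlinarith [hz.2]
      linarith
  have hE1 : Set.EqOn (fun _ => (0 : ℝ)) (fun z => α * z ^ (α - 1) * f (y * z))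
      (Set.uIoo 0 v⁻¹) := fun z hz => by
    rw [Set.uIoo_of_le hvi.1] at hz
    have : y * z < xs := by
      have : v * z < 1 := by simpa [hv0.ne'] using mul_lt_mul_of_pos_left hz.2 hv0
      rw [hyv]; nlinarith
    simp only [hf, extendBelow_of_lt this, mul_zero]
  have hE2 : Set.EqOn (fun z => α * z ^ (α - 1) * (Real.log (v * z) + 1 / α))
      (fun z => α * z ^ (α - 1) * f (y * z)) (Set.uIoo v⁻¹ 1) := fun z hz => by
    rw [Set.uIoo_of_le hvi.2] at hz
    have : xs ≤ y * z := by
      have := hmaps z hz.1.le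
      rw [hyv]; nlinarith
    have h2 : y * z / xs = v * z := by rw [hv]; ring
    simp only [hf, extendBelow_of_le this, h2]
  have hne (z : ℝ) (hz : z ∈ Set.uIcc v⁻¹ 1) : z ≠ 0 := by
    rw [Set.uIcc_of_le hvi.2] at hz
    exact ((inv_pos.2 hv0).trans_le hz.1).ne'
  have hI2 : IntervalIntegrable (fun z : ℝ => α * z ^ (α - 1) * (Real.log (v * z) + 1 / α))
      volume v⁻¹ 1 := by
    refine ContinuousOn.intervalIntegrable (ContinuousOn.mul ?_ (ContinuousOn.add ?_ ?_))
    · exact continuousOn_const.mul (continuousOn_id.rpow_const fun z hz => Or.inl (hne z hz))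
    · exact ContinuousOn.log (by fun_prop) fun z hz => mul_ne_zero hv0.ne' (hne z hz)
    · exact continuousOn_const
  have hder (z : ℝ) (hz : z ∈ Set.uIcc v⁻¹ 1) :
      HasDerivAt (fun z => z ^ α * Real.log (v * z))
        (α * z ^ (α - 1) * (Real.log (v * z) + 1 / α)) z := by
    have hz0 := hne z hz
    have h1 : HasDerivAt (fun z : ℝ => z ^ α) (α * z ^ (α - 1)) z :=
      Real.hasDerivAt_rpow_const (Or.inl hz0)
    have h2 := ((hasDerivAt_id z).const_mul v).log (mul_ne_zero hv0.ne' hz0)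
    convert! h1.mul h2 using 1
    have h4 : z ^ α = z ^ (α - 1) * z := by rw [← Real.rpow_add_one hz0]; simp
    simp only [id, h4]
    field_simp
  rw [← ofReal_integral_eq_lintegral_ofReal hint (ae_of_all _ fun z => hf0 _),
    integral_betaMeasure_one hα, ← intervalIntegral.integral_add_adjacent_intervals
    (intervalIntegrable_const.congr_uIoo hE1) (hI2.congr_uIoo hE2),
    ← intervalIntegral.integral_congr_uIoo hE1, ← intervalIntegral.integral_congr_uIoo hE2,
    intervalIntegral.integral_eq_sub_of_hasDerivAt hder hI2]
  simp [hv0.ne']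

theorem lintegral_expMeasure_add_mul (hlam : 0 < lam) {A : ℝ} (hA : 0 ≤ A) (hr : 0 < r) :
    ∫⁻ t, ENNReal.ofReal (A + r * t) ∂expMeasure lam = ENNReal.ofReal (A + r / lam) := by
  have h : expMeasure lam = volume.withDensity (exponentialPDF lam) := rfl
  have hm : Measurable (exponentialPDF lam) := (measurable_exponentialPDFReal lam).ennreal_ofReal
  have hder (t : ℝ) : HasDerivAt (fun t => -((A + r * t + r / lam) * Real.exp (-lam * t)))
      (lam * Real.exp (-lam * t) * (A + r * t)) t := by
    have h1 : HasDerivAt (fun t => A + r * t + r / lam) (r * 1) t :=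
      (((hasDerivAt_id t).const_mul r).const_add A).add_const _
    have h2 : HasDerivAt (fun t => Real.exp (-lam * t)) (Real.exp (-lam * t) * (-lam * 1)) t :=
      ((hasDerivAt_id t).const_mul (-lam)).exp
    convert! (h1.mul h2).neg using 1
    field_simp
    ring
  have hnn (t : ℝ) (ht : t ∈ Set.Ioi (0 : ℝ)) : 0 ≤ lam * Real.exp (-lam * t) * (A + r * t) := by
    have : 0 < t := ht
    positivity
  have hlim : Tendsto (fun t => -((A + r * t + r / lam) * Real.exp (-lam * t))) atTop (𝓝 0) := by
    have h1 : Tendsto (fun t : ℝ => t ^ 1 * Real.exp (-(lam * t))) atTop (𝓝 0) := by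
      have := (Real.tendsto_pow_mul_exp_neg_atTop_nhds_zero 1).comp
        (tendsto_id.const_mul_atTop hlam)
      have := this.const_mul (1 / lam)
      rw [mul_zero] at this
      refine this.congr fun t => ?_
      simp only [Function.comp, id]
      field_simp
    have h2 : Tendsto (fun t => Real.exp (-(lam * t))) atTop (𝓝 0) :=
      Real.tendsto_exp_neg_atTop_nhds_zero.comp (tendsto_id.const_mul_atTop hlam)
    have := ((h2.const_mul (A + r / lam)).add (h1.const_mul r)).neg
    simp only [mul_zero, add_zero, neg_zero] at this
    exact this.congr fun t => by rw [neg_mul]; ring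
  have hI := integrableOn_Ioi_deriv_of_nonneg' (fun t _ => hder t) hnn hlim
  have hv := integral_Ioi_of_hasDerivAt_of_nonneg' (fun t _ => hder t) hnn hlim
  rw [h, lintegral_withDensity_eq_lintegral_mul _ hm (by fun_prop)]
  calc _ = ∫⁻ t in Set.Ioi 0, ENNReal.ofReal (lam * Real.exp (-lam * t) * (A + r * t)) := by
        rw [← lintegral_indicator measurableSet_Ioi]
        refine lintegral_congr_ae ?_
        have h0 : ∀ᵐ t : ℝ, t ∉ ({0} : Set ℝ) :=
          measure_eq_zero_iff_ae_notMem.1 (measure_singleton 0)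
        filter_upwards [h0] with t ht0
        by_cases ht : 0 < t
        · rw [Set.indicator_of_mem (by exact ht), Pi.mul_apply, exponentialPDF_of_nonneg ht.le,
            ← ENNReal.ofReal_mul (by positivity), neg_mul]
        · rw [Set.indicator_of_notMem (by exact ht), Pi.mul_apply, exponentialPDF_of_neg, zero_mul]
          exact lt_of_le_of_ne (not_lt.1 ht) ht0
    _ = _ := by
        rw [← ofReal_integral_eq_lintegral_ofReal hI
          ((ae_restrict_mem measurableSet_Ioi).mono hnn), hv]
        simp

/-- Without discounting, `log (x / xs) + 1 / α` is a supersolution if the growth rate is at most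
the critical one. -/
theorem discountedNext_log_le (hlam : 0 < lam) (hα : 0 < α) (hr : 0 < r) (hxs : 0 < xs)
    (hcrit : α * r ≤ lam) {x : ℝ} (hx : xs ≤ x) :
    discountedNext r xs 0 (stepLaw lam α)
      (fun y => ENNReal.ofReal (extendBelow xs 0 (fun v => Real.log v + 1 / α) y)) x ≤
      ENNReal.ofReal (extendBelow xs 0 (fun v => Real.log v + 1 / α) x) := by
  have := isProbabilityMeasure_expMeasure hlam
  have := isProbabilityMeasureBeta hα zero_lt_one
  have hfm : Measurable (extendBelow xs 0 fun v => Real.log v + 1 / α) := by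
    refine measurable_extendBelow hxs (ContinuousOn.add ?_ continuousOn_const)
    exact Real.continuousOn_log.mono fun v hv => (zero_lt_one.trans_le hv).ne'
  have hx1 : 1 ≤ x / xs := (one_le_div hxs).2 hx
  rw [discountedNext, stepLaw, lintegral_prod _
    (measurable_discountedNext_integrand_right hfm.ennreal_ofReal x).aemeasurable]
  simp only [neg_zero, zero_mul, Real.exp_zero, ENNReal.ofReal_one, one_mul]
  simp only [lintegral_betaMeasure_log hα hxs (le_grow hx)]
  -- The grown capital is at most x * exp (r t). The mean gain r / lam of the logarithm is then at
  -- most the mean loss 1 / α, which is `hcrit`.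
  calc _ ≤ ∫⁻ t, ENNReal.ofReal (Real.log (x / xs) + r * t) ∂expMeasure lam := by
        refine lintegral_mono_ae ?_
        filter_upwards [ae_pos_expMeasure lam] with t ht
        refine ENNReal.ofReal_le_ofReal ?_
        have h1 : 1 ≤ Real.exp (r * t) := Real.one_le_exp (by positivity)
        rw [← Real.log_exp (r * t), ← Real.log_mul (by linarith) (Real.exp_pos _).ne',
          grow_of_le hx]
        refine Real.log_le_log (div_pos ?_ hxs) ?_
        · nlinarith [mul_nonneg (sub_nonneg.2 hx) (Real.exp_pos (r * t)).le]
        · rw [div_mul_eq_mul_div]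
          gcongr
          nlinarith
    _ ≤ _ := by
        rw [lintegral_expMeasure_add_mul hlam (Real.log_nonneg hx1) hr, extendBelow_of_le hx]
        refine ENNReal.ofReal_le_ofReal ?_
        have : r / lam ≤ 1 / α := by rw [div_le_div_iff₀ hlam hα]; linarith
        linarith

/-- Without discounting and without a growth rate above the critical one, trapping is certain. -/
theorem iSup_trappingIter_eq_one (hlam : 0 < lam) (hα : 0 < α) (hr : 0 < r) (hxs : 0 < xs)
    (hcrit : α * r ≤ lam) (x : ℝ) :
    ⨆ n, trappingIter r xs 0 (stepLaw lam α) n x = 1 := by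
  have := isProbabilityMeasure_stepLaw hlam hα
  have hone (y : ℝ) : discountedNext r xs 0 (stepLaw lam α) (fun _ => 1) y = 1 := by
    simp [discountedNext]
  refine le_antisymm (iSup_le fun n => trappingIter_le (fun _ _ => rfl)
    (fun y _ => (hone y).le) n x) ?_
  rcases lt_or_ge x xs with hx | hx
  · rw [iSup_trappingIter_of_lt hx]
  set D : ℝ → ℝ≥0∞ := fun y => 1 - ⨆ n, trappingIter r xs 0 (stepLaw lam α) n y with hD
  set V : ℝ → ℝ≥0∞ := fun y =>
    ENNReal.ofReal (extendBelow xs 0 (fun v => Real.log v + 1 / α) y) with hV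
  have hVm : Measurable V := by
    refine (measurable_extendBelow hxs (ContinuousOn.add ?_ continuousOn_const)).ennreal_ofReal
    exact Real.continuousOn_log.mono fun v hv => (zero_lt_one.trans_le hv).ne'
  -- The survival probability `D` need not be known to vanish at infinity, but the truncated
  -- difference D - ε V is a subsolution that is zero once ε V ≥ 1. Then ε tends to 0.
  have key (ε : ℝ) (hε : 0 < ε) : D x ≤ ENNReal.ofReal ε * V x := by
    refine tsub_eq_zero_iff_le.1 (eq_zero_of_le_discountedNext hlam hα hr hxs le_rfl
      ENNReal.one_ne_top (D := fun y => D y - ENNReal.ofReal ε * V y)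
      (fun y => tsub_le_self.trans tsub_le_self) (fun y hy => ?_) (fun y hy => ?_)
      (fun η hη => ?_) x)
    · simp only [hD, iSup_trappingIter_of_lt hy, tsub_self, zero_tsub]
    · refine le_trans ?_ (discountedNext_sub_le (hVm.const_mul _) y)
      rw [discountedNext_const_mul hVm]
      exact tsub_le_tsub (sub_iSup_trappingIter_le hlam hα (fun y _ => (hone y).ge) hy)
        (mul_le_mul_right (discountedNext_log_le hlam hα hr hxs hcrit hy) _)
    · refine ⟨max xs (xs * Real.exp (1 / ε)), fun y hy => ?_⟩
      have h1 : xs ≤ y := (le_max_left _ _).trans hy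
      have h2 : Real.exp (1 / ε) ≤ y / xs := by
        rw [le_div_iff₀ hxs, mul_comm]; exact (le_max_right _ _).trans hy
      have h3 : 1 / ε ≤ Real.log (y / xs) :=
        (Real.le_log_iff_exp_le ((Real.exp_pos _).trans_le h2)).2 h2
      have h4 : 1 ≤ ENNReal.ofReal ε * V y := by
        rw [hV, ← ENNReal.ofReal_mul hε.le, ENNReal.one_le_ofReal, extendBelow_of_le h1]
        have h5 : 0 < 1 / α := by positivity
        calc (1 : ℝ) = ε * (1 / ε) := by field_simp
          _ ≤ _ := by gcongr; linarith
      rw [tsub_eq_zero_of_le (tsub_le_self.trans h4)]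
      exact zero_le
  have h0 : D x ≤ 0 := by
    have hlim : Tendsto (fun n : ℕ => ENNReal.ofReal (1 / ((n : ℝ) + 1)) * V x) atTop
        (𝓝 (ENNReal.ofReal 0 * V x)) :=
      ENNReal.Tendsto.mul_const (ENNReal.tendsto_ofReal tendsto_one_div_add_atTop_nhds_zero_nat)
        (Or.inr ENNReal.ofReal_ne_top)
    rw [ENNReal.ofReal_zero, zero_mul] at hlim
    exact ge_of_tendsto' hlim fun n => key _ (by positivity)
  exact tsub_eq_zero_iff_le.1 (nonpos_iff_eq_zero.1 h0)

end Identification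

theorem ofReal_integral_le_lintegral_ofReal {β : Type*} [MeasurableSpace β] {μ : Measure β}
    {f : β → ℝ} (hf : Integrable f μ) :
    ENNReal.ofReal (∫ x, f x ∂μ) ≤ ∫⁻ x, ENNReal.ofReal (f x) ∂μ := by
  rw [integral_eq_lintegral_pos_part_sub_lintegral_neg_part hf]
  exact (ENNReal.ofReal_le_ofReal (sub_le_self _ ENNReal.toReal_nonneg)).trans
    ENNReal.ofReal_toReal_le

theorem tendsto_rpow_neg_div_atTop {b xs : ℝ} (hb : 0 < b) (hxs : 0 < xs) (C : ℝ) :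
    Tendsto (fun x : ℝ => (x / xs) ^ (-b) * C) atTop (𝓝 0) := by
  have := ((tendsto_rpow_neg_atTop hb).comp (tendsto_id.atTop_div_const hxs)).mul_const C
  rwa [zero_mul] at this

theorem exists_forall_ge_le_of_tendsto {f : ℝ → ℝ} (hf : Tendsto f atTop (𝓝 0)) {D : ℝ → ℝ≥0∞}
    {xs : ℝ} (hD : ∀ x, xs ≤ x → D x ≤ ENNReal.ofReal (f x)) (ε : ℝ≥0∞) (hε : 0 < ε) :
    ∃ R, ∀ x, R ≤ x → D x ≤ ε := by
  have h := ENNReal.tendsto_ofReal hf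
  rw [ENNReal.ofReal_zero] at h
  obtain ⟨R, hR⟩ := eventually_atTop.1 (h.eventually_le_const hε)
  exact ⟨max R xs, fun x hx => (hD x ((le_max_right _ _).trans hx)).trans
    (hR x ((le_max_left _ _).trans hx))⟩

/-! ### The series solution equals the discounted trapping probability -/

section Solution

variable {lam δ r α b xs : ℝ} {c : ℕ → ℝ}

theorem abs_extendBelow_invPowerSum_le (hxs : 0 < xs) (hc : Summable fun n => |c n|) (κ : ℝ)
    {x : ℝ} (hx : xs ≤ x) :
    |extendBelow xs κ (invPowerSum b c) x| ≤ (x / xs) ^ (-b) * ∑' n, |c n| := by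
  rw [extendBelow_of_le hx]
  exact abs_invPowerSum_le hc ((one_le_div hxs).2 hx)

/-- If the value at `1` vanished, the solution would vanish identically. -/
theorem tsum_ne_zero_of_renewal (hlam : 0 < lam) (hα : 0 < α) (hr : 0 < r)
    (hδ : 0 ≤ δ) (hb : 0 < b) (hc0 : c 0 ≠ 0)
    (he : ∀ n : ℕ, shiftedCoefficient lam δ r b c n * (α - b - n) = α * c n)
    (hc : Summable fun n => |c n|) (hc' : Summable fun n => |shiftedCoefficient lam δ r b c n|)
    (h1 : ∑' n, shiftedCoefficient lam δ r b c n = (lam + δ) * (∑' n, c n) / lam) :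
    ∑' n, c n ≠ 0 := by
  intro hzero
  have hκ : ∑' n, shiftedCoefficient lam δ r b c n = 0 := by rw [h1, hzero]; simp
  have hren {x : ℝ} (hx : (1 : ℝ) ≤ x) :=
    (integral_prod_extendBelow (r := r) hlam hδ hb.le hα one_pos he hc hc' h1 hx).2
  rw [hκ] at hren
  set w := extendBelow 1 0 (invPowerSum b c) with hw
  -- With κ = 0 the renewal equation is homogeneous, so the absolute value of its solution is a
  -- subsolution.
  have hD : ∀ x, ‖w x‖ₑ = 0 := by
    refine eq_zero_of_le_discountedNext hlam hα hr one_pos hδ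
      (C := ENNReal.ofReal (∑' n, |c n|)) ENNReal.ofReal_ne_top (fun x => ?_) (fun x hx => ?_)
      (fun x hx => ?_) ?_
    · rw [Real.enorm_eq_ofReal_abs]
      refine ENNReal.ofReal_le_ofReal ((abs_extendBelow_le one_pos
        (fun v hv => abs_invPowerSum_le_tsum hb.le hc hv) x).trans ?_)
      rw [abs_zero, max_eq_right (tsum_nonneg fun _ => abs_nonneg _)]
    · rw [hw, extendBelow_of_lt hx, enorm_zero]
    · have hwx : w x = invPowerSum b c (x / 1) := extendBelow_of_le hx
      rw [hwx, ← hren hx]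
      refine (enorm_integral_le_lintegral_enorm _).trans_eq (lintegral_congr fun p => ?_)
      rw [enorm_mul, Real.enorm_eq_ofReal_abs (Real.exp _), Real.abs_exp]
    · refine exists_forall_ge_le_of_tendsto (xs := 1)
        (tendsto_rpow_neg_div_atTop hb one_pos (∑' n, |c n|)) fun x hx => ?_
      rw [Real.enorm_eq_ofReal_abs]
      exact ENNReal.ofReal_le_ofReal (abs_extendBelow_invPowerSum_le one_pos hc 0 hx)
  have hz (z : ℝ) (hz : z ∈ Set.Ioc (0 : ℝ) 1) : powerSum c z = 0 := by
    have h2 := hD z⁻¹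
    have h3 : 1 ≤ z⁻¹ := (one_le_inv₀ hz.1).2 hz.2
    rw [enorm_eq_zero, hw, extendBelow_of_le h3, invPowerSum, div_one, inv_inv] at h2
    exact (mul_eq_zero.1 h2).resolve_left (Real.rpow_pos_of_pos (inv_pos.2 hz.1) _).ne'
  -- The limit z → 0 corresponds to infinite capital and isolates the leading coefficient `c 0`.
  have hcont : Tendsto (powerSum c) (𝓝[Set.Ioc 0 1] 0) (𝓝 (powerSum c 0)) :=
    ((continuousOn_powerSum hc) 0 ⟨le_rfl, zero_le_one⟩).mono_left
      (nhdsWithin_mono _ Set.Ioc_subset_Icc_self)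
  have hne : (𝓝[Set.Ioc (0 : ℝ) 1] 0).NeBot := by
    rw [← mem_closure_iff_nhdsWithin_neBot, closure_Ioc zero_ne_one]
    exact ⟨le_rfl, zero_le_one⟩
  have h0 : powerSum c 0 = 0 := tendsto_nhds_unique hcont
    (tendsto_const_nhds.congr' (by
      filter_upwards [self_mem_nhdsWithin] with z hz' using (hz z hz').symm))
  apply hc0
  rw [← h0, powerSum, tsum_eq_single 0 fun n hn => by simp [hn]]
  simp

/-- The discounted trapping probability in terms of a solution that vanishes at infinity. -/
theorem iSup_trappingIter_eq_ofReal (hlam : 0 < lam) (hα : 0 < α) (hr : 0 < r) (hxs : 0 < xs)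
    (hδ : 0 ≤ δ) (hb : 0 < b)
    (he : ∀ n : ℕ, shiftedCoefficient lam δ r b c n * (α - b - n) = α * c n)
    (hc : Summable fun n => |c n|) (hc' : Summable fun n => |shiftedCoefficient lam δ r b c n|)
    (h1 : ∑' n, shiftedCoefficient lam δ r b c n = (lam + δ) * (∑' n, c n) / lam)
    (hne : ∑' n, c n ≠ 0) {x : ℝ} (hx : xs ≤ x) :
    0 ≤ lam * invPowerSum b c (x / xs) / ((lam + δ) * ∑' n, c n) ∧
    ⨆ n, trappingIter r xs δ (stepLaw lam α) n x =
      ENNReal.ofReal (lam * invPowerSum b c (x / xs) / ((lam + δ) * ∑' n, c n)) := by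
  set κ := ∑' n, shiftedCoefficient lam δ r b c n with hκdef
  have hκ : κ ≠ 0 := by
    rw [h1]
    exact div_ne_zero (mul_ne_zero (by linarith) hne) hlam.ne'
  have hren {x : ℝ} (hx : xs ≤ x) :=
    integral_prod_extendBelow (r := r) hlam hδ hb.le hα hxs he hc hc' h1 hx
  rw [← hκdef] at hren
  set w : ℝ → ℝ := fun x => extendBelow xs κ (invPowerSum b c) x / κ with hw
  set C := max |κ| (∑' n, |c n|) / |κ| with hC
  have hwC (x : ℝ) : |w x| ≤ C := by
    rw [hw, abs_div]
    exact div_le_div_of_nonneg_right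
      (abs_extendBelow_le hxs (fun v hv => abs_invPowerSum_le_tsum hb.le hc hv) x) (abs_nonneg _)
  have hw1 (x : ℝ) (hx : x < xs) : w x = 1 := by
    simp only [hw, extendBelow_of_lt hx, div_self hκ]
  have hwint {x : ℝ} (hx : xs ≤ x) :
      Integrable (fun p : ℝ × ℝ => Real.exp (-δ * p.1) * w (Household.grow r xs p.1 x * p.2))
        (stepLaw lam α) :=
    ((hren hx).1.div_const κ).congr (ae_of_all _ fun p => mul_div_assoc _ _ _)
  have hweq {x : ℝ} (hx : xs ≤ x) : ∫ p, Real.exp (-δ * p.1) *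
      w (Household.grow r xs p.1 x * p.2) ∂stepLaw lam α = w x := by
    simp only [hw, ← mul_div_assoc]
    rw [integral_div, stepLaw, (hren hx).2, extendBelow_of_le hx]
  have hdecay (x : ℝ) (hx : xs ≤ x) : |w x| ≤ (x / xs) ^ (-b) * ((∑' n, |c n|) / |κ|) := by
    rw [hw, abs_div, ← mul_div_assoc]
    exact div_le_div_of_nonneg_right (abs_extendBelow_invPowerSum_le hxs hc κ hx) (abs_nonneg _)
  -- The signs of the series are not visible from its terms; the maximum principle is applied to the
  -- negative part of `w`.
  have hnonneg (x : ℝ) : 0 ≤ w x := by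
    have := eq_zero_of_le_discountedNext (D := fun x => ENNReal.ofReal (-w x)) hlam hα hr hxs hδ
      (C := ENNReal.ofReal C) ENNReal.ofReal_ne_top
      (fun x => ENNReal.ofReal_le_ofReal ((neg_le_abs _).trans (hwC x)))
      (fun x hx => by simp only [hw1 x hx]; simp) (fun x hx => ?_)
      (exists_forall_ge_le_of_tendsto (xs := xs)
        (tendsto_rpow_neg_div_atTop hb hxs ((∑' n, |c n|) / |κ|)) fun x hx =>
          ENNReal.ofReal_le_ofReal ((neg_le_abs _).trans (hdecay x hx))) x
    · rw [ENNReal.ofReal_eq_zero] at this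
      linarith
    · rw [← hweq hx, ← integral_neg]
      refine (ofReal_integral_le_lintegral_ofReal (hwint hx).neg).trans_eq
        (lintegral_congr fun p => ?_)
      rw [Pi.neg_apply, ← mul_neg, ENNReal.ofReal_mul (Real.exp_pos _).le]
  have hwx : w x = lam * invPowerSum b c (x / xs) / ((lam + δ) * ∑' n, c n) := by
    simp only [hw]
    rw [extendBelow_of_le hx, h1]
    field_simp
  rw [← hwx]
  refine ⟨hnonneg x, ?_⟩
  refine iSup_trappingIter_eq_of_vanishing (W := fun x => ENNReal.ofReal (w x)) hlam hα hr hxs hδ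
    (C := ENNReal.ofReal C) ENNReal.ofReal_ne_top
    (fun x => ENNReal.ofReal_le_ofReal ((le_abs_self _).trans (hwC x)))
    (fun x hx => by rw [hw1 x hx, ENNReal.ofReal_one]) (fun x hx => ?_)
    (exists_forall_ge_le_of_tendsto (xs := xs)
      (tendsto_rpow_neg_div_atTop hb hxs ((∑' n, |c n|) / |κ|)) fun x hx =>
        ENNReal.ofReal_le_ofReal ((le_abs_self _).trans (hdecay x hx))) x
  rw [← hweq hx, ofReal_integral_eq_lintegral_ofReal (hwint hx)
    (ae_of_all _ fun p => mul_nonneg (Real.exp_pos _).le (hnonneg _))]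
  exact lintegral_congr fun p => by rw [ENNReal.ofReal_mul (Real.exp_pos _).le]

end Solution

/-- The discounted trapping probability in terms of the hypergeometric function. -/
theorem trapping_hypergeometric {r xs lam α δ x a b : ℝ}
    (hr : 0 < r) (hxs : 0 < xs) (hlam : 0 < lam) (hα : 0 < α) (hδ : 0 ≤ δ) (hx : xs ≤ x)
    (ha : a = (-(δ + lam - α * r) - √((δ + lam - α * r) ^ 2 + 4 * r * α * δ)) / (2 * r))
    (hb : b = (-(δ + lam - α * r) + √((δ + lam - α * r) ^ 2 + 4 * r * α * δ)) / (2 * r)) :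
    (Summable fun n => |ordinaryHypergeometricCoefficient b (b - α + 1) (b - a + 1) n|) ∧
    ₂F₁ b (b - α + 1) (b - a + 1) (1 : ℝ) ≠ 0 ∧
    0 ≤ lam * ₂F₁ b (b - α + 1) (b - a + 1) (x / xs)⁻¹ /
        ((lam + δ) * ₂F₁ b (b - α + 1) (b - a + 1) (1 : ℝ)) * (x / xs) ^ (-b) ∧
    ⨆ n, trappingIter r xs δ (stepLaw lam α) n x =
      ENNReal.ofReal (lam * ₂F₁ b (b - α + 1) (b - a + 1) (x / xs)⁻¹ /
        ((lam + δ) * ₂F₁ b (b - α + 1) (b - a + 1) (1 : ℝ)) * (x / xs) ^ (-b)) := by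
  set k := δ + lam - α * r with hk
  have hprod : 0 ≤ 4 * r * α * δ := by positivity
  set s := √(k ^ 2 + 4 * r * α * δ) with hs
  have hs2 : s ^ 2 = k ^ 2 + 4 * r * α * δ := Real.sq_sqrt (by positivity)
  have hsk : |k| ≤ s := Real.abs_le_sqrt (by linarith)
  have hb0 : 0 ≤ b := by
    rw [hb]
    exact div_nonneg (by linarith [le_abs_self k]) (by linarith)
  have hab : a + b = -k / r := by rw [ha, hb]; field_simp; ring
  have hquad : r * b ^ 2 + k * b - α * δ = 0 := by
    rw [hb]
    field_simp
    linear_combination hs2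
  have hs1 : 0 < b - a + 1 := by
    have : b - a = s / r := by rw [ha, hb]; field_simp; ring
    rw [this]
    have : 0 ≤ s := Real.sqrt_nonneg _
    positivity
  have hpq : 0 < b - a + 1 - b - (b - α + 1) := by
    have : b - a + 1 - b - (b - α + 1) = (δ + lam) / r := by
      rw [show b - a + 1 - b - (b - α + 1) = α - (a + b) by ring, hab, hk]
      field_simp
      ring
    rw [this]
    positivity
  have hc := ordinaryHypergeometricCoefficient_succ (p := b) (q := b - α + 1) hs1
  set c := ordinaryHypergeometricCoefficient b (b - α + 1) (b - a + 1) with hcdef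
  have hc0 : c 0 = 1 := ordinaryHypergeometricCoefficient_zero _ _ _
  have hsum := summable_abs_of_hypergeometric_recurrence hs1 hpq hc
  have hlim := tendsto_natCast_mul_of_hypergeometric_recurrence hs1 hc hsum
  have he := shiftedCoefficient_mul hr hlam hab hquad hc
  have hsum' := summable_abs_shiftedCoefficient he hsum
  have htsum := tsum_shiftedCoefficient hsum hlim hsum'
  have hF (z : ℝ) : ₂F₁ b (b - α + 1) (b - a + 1) z = powerSum c z :=
    ordinaryHypergeometric_eq_tsum_mul_pow _ _ _ z
  have hF1 : powerSum c 1 = ∑' n, c n := by simp [powerSum]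
  rw [hF, hF, hF1]
  have hcomm : lam * powerSum c (x / xs)⁻¹ / ((lam + δ) * ∑' n, c n) * (x / xs) ^ (-b) =
      lam * invPowerSum b c (x / xs) / ((lam + δ) * ∑' n, c n) := by
    rw [invPowerSum]; ring
  rw [hcomm]
  -- For b > 0 the factor v ^ (-b) gives decay at infinity. If b = 0, the quadratic equation forces
  -- δ = 0, the formula for b forces α r ≤ lam, and the recurrence kills every c n with n ≥ 1.
  rcases hb0.lt_or_eq with hb0 | hb0
  · have hne := tsum_ne_zero_of_renewal hlam hα hr hδ hb0 (by rw [hc0]; exact one_ne_zero)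
      he hsum hsum' htsum
    exact ⟨hsum, hne, iSup_trappingIter_eq_ofReal hlam hα hr hxs hδ hb0 he hsum hsum' htsum hne hx⟩
  · have hδ0 : δ = 0 := by
      rw [← hb0] at hquad
      have : α * δ = 0 := by linarith
      exact (mul_eq_zero.1 this).resolve_left hα.ne'
    have hcrit : α * r ≤ lam := by
      have h1 : -k + s = 0 := by
        rw [hb, eq_comm, div_eq_zero_iff] at hb0
        exact hb0.resolve_right (by positivity)
      have h2 : 0 ≤ s := Real.sqrt_nonneg _
      linarith
    have hcs (n : ℕ) (hn : n ≠ 0) : c n = 0 := by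
      induction n with
      | zero => exact absurd rfl hn
      | succ n ih =>
        have h1 : ((n : ℝ) + 1) * (b - a + 1 + n) ≠ 0 := by positivity
        have h2 := hc n
        rcases eq_or_ne n 0 with rfl | hn0
        · rw [← hb0] at h2 h1
          simp only [Nat.cast_zero, add_zero, zero_mul] at h2 h1
          exact (mul_eq_zero.1 h2).resolve_left h1
        · rw [ih hn0, mul_zero] at h2
          exact (mul_eq_zero.1 h2).resolve_left h1
    have hP (z : ℝ) : powerSum c z = 1 := by
      rw [powerSum, tsum_eq_single 0 fun n hn => by rw [hcs n hn, zero_mul], hc0]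
      simp
    have hval : lam * invPowerSum b c (x / xs) / ((lam + δ) * ∑' n, c n) = 1 := by
      rw [invPowerSum, hP, ← hF1, hP, ← hb0, hδ0, neg_zero, Real.rpow_zero, add_zero]
      field_simp
    rw [hval, ← hF1, hP, hδ0]
    exact ⟨hsum, one_ne_zero, zero_le_one, by
      rw [ENNReal.ofReal_one]; exact iSup_trappingIter_eq_one hlam hα hr hxs hcrit x⟩

/-! ### Paths: the trapping time in terms of the stopped chain -/

/-- The capital at the event times and the discount factor, both stopped when the capital is
below `xs`, in terms of the inter-arrival times `S` and the remaining proportions `Z`. -/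
noncomputable def stoppedChain (r xs δ x : ℝ) (S Z : ℕ → ℝ) : ℕ → ℝ × ℝ
  | 0 => (x, 1)
  | n + 1 =>
    if (stoppedChain r xs δ x S Z n).1 < xs then stoppedChain r xs δ x S Z n
    else (Household.grow r xs (S n) (stoppedChain r xs δ x S Z n).1 * Z n,
      (stoppedChain r xs δ x S Z n).2 * Real.exp (-δ * S n))

section Path

variable {r xs δ x : ℝ} {T Z : ℕ → ℝ}

/-- This reduces trapping in continuous time to the event times. -/
theorem grow_lt_iff {s u : ℝ} : Household.grow r xs s u < xs ↔ u < xs := by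
  unfold Household.grow
  split_ifs with h
  · have : 0 < (u - xs) * Real.exp (r * s) := mul_pos (by linarith) (Real.exp_pos _)
    constructor <;> intro <;> linarith
  · exact Iff.rfl

theorem eventCount_eq (hT : StrictMono T) {t : ℝ} {n : ℕ} (h1 : T n ≤ t) (h2 : t < T (n + 1)) :
    Household.eventCount T t = n := by
  have : {i : ℕ | 1 ≤ i ∧ T i ≤ t} = Set.Icc 1 n := by
    ext i
    refine and_congr_right fun _ => ⟨fun h => ?_, fun h => (hT.monotone h).trans h1⟩
    exact Nat.lt_succ_iff.1 (hT.lt_iff_lt.1 (h.trans_lt h2))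
  rw [Household.eventCount, this, Set.ncard_eq_toFinset_card']
  simp

theorem exists_event_interval (hT0 : T 0 = 0) (hlim : Tendsto T atTop atTop) {t : ℝ}
    (ht : 0 ≤ t) : ∃ n, T n ≤ t ∧ t < T (n + 1) := by
  obtain ⟨m, hm⟩ := (hlim.eventually_gt_atTop t).exists
  classical
  have hex : ∃ m, t < T m := ⟨m, hm⟩
  have h0 : Nat.find hex ≠ 0 := fun h => by
    have := Nat.find_spec hex
    rw [h, hT0] at this
    linarith
  obtain ⟨n, hn⟩ := Nat.exists_eq_succ_of_ne_zero h0
  refine ⟨n, not_lt.1 (Nat.find_min hex (by omega)), ?_⟩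
  have := Nat.find_spec hex
  rwa [hn] at this

theorem capital_lt_iff (hT : StrictMono T) {t : ℝ≥0} {n : ℕ} (h1 : T n ≤ t)
    (h2 : (t : ℝ) < T (n + 1)) :
    Household.capital r xs x T Z t < xs ↔ Household.eventCapital r xs x T Z n < xs := by
  rw [Household.capital, eventCount_eq hT h1 h2, grow_lt_iff]

theorem trappingTime_eq_top (hT0 : T 0 = 0) (hT : StrictMono T) (hlim : Tendsto T atTop atTop)
    (h : ∀ n, xs ≤ Household.eventCapital r xs x T Z n) :
    Household.trappingTime r xs x T Z = ∞ := by
  simp only [Household.trappingTime, iInf_eq_top]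
  intro t ht
  obtain ⟨n, h1, h2⟩ := exists_event_interval hT0 hlim t.2
  exact absurd ((capital_lt_iff hT h1 h2).1 ht) (h n).not_gt

theorem trappingTime_eq_ofReal (hT0 : T 0 = 0) (hT : StrictMono T)
    (hlim : Tendsto T atTop atTop) {k : ℕ} (hk : Household.eventCapital r xs x T Z k < xs)
    (h : ∀ n < k, xs ≤ Household.eventCapital r xs x T Z n) :
    Household.trappingTime r xs x T Z = ENNReal.ofReal (T k) := by
  have hTk : 0 ≤ T k := hT0 ▸ hT.monotone k.zero_le
  refine le_antisymm ?_ (le_iInf₂ fun t ht => ?_)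
  · refine iInf₂_le_of_le (T k).toNNReal ?_ le_rfl
    rw [capital_lt_iff hT (n := k)]
    · exact hk
    · rw [Real.coe_toNNReal _ hTk]
    · rw [Real.coe_toNNReal _ hTk]; exact hT k.lt_succ_self
  · obtain ⟨n, h1, h2⟩ := exists_event_interval hT0 hlim t.2
    have h3 := (capital_lt_iff hT h1 h2).1 ht
    have hkn : k ≤ n := not_lt.1 fun hn => (h n hn).not_gt h3
    rw [← ENNReal.ofReal_coe_nnreal]
    exact ENNReal.ofReal_le_ofReal ((hT.monotone hkn).trans h1)

/-- Only the capitals before the event `n` must be at least xs, so the identity still covers the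
trapping event itself. -/
theorem stoppedChain_eq (hT0 : T 0 = 0) {n : ℕ}
    (h : ∀ i < n, xs ≤ Household.eventCapital r xs x T Z i) :
    stoppedChain r xs δ x (fun i => T (i + 1) - T i) Z n =
      (Household.eventCapital r xs x T Z n, Real.exp (-δ * T n)) := by
  induction n with
  | zero => simp [stoppedChain, Household.eventCapital, hT0]
  | succ n ih =>
    rw [stoppedChain, ih fun i hi => h i (hi.trans n.lt_succ_self),
      if_neg (h n n.lt_succ_self).not_gt, Household.eventCapital, ← Real.exp_add]
    ring_nf

theorem stoppedChain_of_le {S : ℕ → ℝ} {k n : ℕ} (hk : (stoppedChain r xs δ x S Z k).1 < xs)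
    (hkn : k ≤ n) : stoppedChain r xs δ x S Z n = stoppedChain r xs δ x S Z k := by
  induction n, hkn using Nat.le_induction with
  | base => rfl
  | succ n _ ih => rw [stoppedChain, ih, if_pos hk]

/-- The discount factor on the event that trapping has occurred by the event `n`. -/
noncomputable def stoppedDiscount (r xs δ x : ℝ) (S Z : ℕ → ℝ) (n : ℕ) : ℝ :=
  if (stoppedChain r xs δ x S Z n).1 < xs then (stoppedChain r xs δ x S Z n).2 else 0

/-- The sequence is constant from the first event with capital below xs onwards, and identically 0
if there is none. -/
theorem tendsto_stoppedDiscount (hT0 : T 0 = 0) (hT : StrictMono T)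
    (hlim : Tendsto T atTop atTop) :
    Tendsto (stoppedDiscount r xs δ x (fun i => T (i + 1) - T i) Z) atTop
      (𝓝 (if Household.trappingTime r xs x T Z < ∞ then
        Real.exp (-δ * (Household.trappingTime r xs x T Z).toNNReal) else 0)) := by
  classical
  by_cases hex : ∃ k, Household.eventCapital r xs x T Z k < xs
  · have hmin (n : ℕ) (hn : n < Nat.find hex) : xs ≤ Household.eventCapital r xs x T Z n :=
      not_lt.1 (Nat.find_min hex hn)
    have hspec := Nat.find_spec hex
    set k := Nat.find hex
    have hTk : 0 ≤ T k := hT0 ▸ hT.monotone k.zero_le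
    have hchain := stoppedChain_eq (δ := δ) hT0 hmin
    have hlt : (stoppedChain r xs δ x (fun i => T (i + 1) - T i) Z k).1 < xs := by
      rw [hchain]; exact hspec
    rw [trappingTime_eq_ofReal hT0 hT hlim hspec hmin, if_pos ENNReal.ofReal_lt_top]
    refine tendsto_const_nhds.congr' ?_
    filter_upwards [eventually_ge_atTop k] with n hn
    rw [stoppedDiscount, stoppedChain_of_le hlt hn, if_pos hlt, hchain]
    rw [ENNReal.ofReal, ENNReal.toNNReal_coe, Real.coe_toNNReal _ hTk]
  · push Not at hex
    rw [trappingTime_eq_top hT0 hT hlim hex, if_neg (lt_irrefl _)]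
    refine tendsto_const_nhds.congr fun n => ?_
    rw [stoppedDiscount, if_neg]
    rw [stoppedChain_eq hT0 fun i _ => hex i]
    exact (hex n).not_gt

theorem stoppedChain_snd_nonneg {S : ℕ → ℝ} (n : ℕ) : 0 ≤ (stoppedChain r xs δ x S Z n).2 := by
  induction n with
  | zero => exact zero_le_one
  | succ n ih =>
    rw [stoppedChain]
    split_ifs
    · exact ih
    · exact mul_nonneg ih (Real.exp_pos _).le

theorem stoppedChain_snd_le_one {S : ℕ → ℝ} (hδ : 0 ≤ δ) (hS : ∀ i, 0 ≤ S i) (n : ℕ) :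
    (stoppedChain r xs δ x S Z n).2 ≤ 1 := by
  induction n with
  | zero => exact le_rfl
  | succ n ih =>
    rw [stoppedChain]
    split_ifs
    · exact ih
    · refine mul_le_one₀ ih (Real.exp_pos _).le ?_
      rw [Real.exp_le_one_iff]
      nlinarith [mul_nonneg hδ (hS n)]

end Path

/-- The transition of the stopped chain. -/
noncomputable def chainStep (r xs δ : ℝ) (q : (ℝ × ℝ) × (ℝ × ℝ)) : ℝ × ℝ :=
  if q.1.1 < xs then q.1
  else (Household.grow r xs q.2.1 q.1.1 * q.2.2, q.1.2 * Real.exp (-δ * q.2.1))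

theorem measurable_chainStep (r xs δ : ℝ) : Measurable (chainStep r xs δ) := by
  refine Measurable.ite (measurableSet_lt (by fun_prop) measurable_const) measurable_fst
    (Measurable.prodMk ?_ (by fun_prop))
  exact (measurable_grow_mul r xs).comp
    (by fun_prop : Measurable fun q : (ℝ × ℝ) × (ℝ × ℝ) => (q.1.1, q.2))

theorem stoppedChain_succ (r xs δ x : ℝ) (S Z : ℕ → ℝ) (n : ℕ) :
    stoppedChain r xs δ x S Z (n + 1) =
      chainStep r xs δ (stoppedChain r xs δ x S Z n, (S n, Z n)) := rfl

/-! ### Independence and the Markov property of the stopped chain -/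

section PastSigma

variable {Ω : Type*} {S Z : ℕ → Ω → ℝ}

/-- The information on the first `n` inter-arrival times and proportions. -/
@[reducible] def pastSigma (S Z : ℕ → Ω → ℝ) (n : ℕ) : MeasurableSpace Ω :=
  ⨆ i ∈ {i : ℕ ⊕ ℕ | Sum.elim id id i < n}, MeasurableSpace.comap (Sum.elim S Z i) inferInstance

theorem comap_le_pastSigma {i : ℕ ⊕ ℕ} {n : ℕ} (h : Sum.elim id id i < n) :
    MeasurableSpace.comap (Sum.elim S Z i) inferInstance ≤ pastSigma S Z n :=
  le_iSup₂_of_le i h le_rfl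

theorem pastSigma_mono {m n : ℕ} (h : m ≤ n) : pastSigma S Z m ≤ pastSigma S Z n :=
  iSup₂_le fun _ hi => comap_le_pastSigma (lt_of_lt_of_le hi h)

theorem measurable_stoppedChain_pastSigma (r xs δ x : ℝ) (n : ℕ) :
    Measurable[pastSigma S Z n]
      fun ω => stoppedChain r xs δ x (fun i => S i ω) (fun i => Z i ω) n := by
  induction n with
  | zero => exact @measurable_const _ _ _ (pastSigma S Z 0) _
  | succ n ih =>
    simp only [stoppedChain_succ]
    have hS : Measurable[pastSigma S Z (n + 1)] (S n) :=
      (comap_measurable (S n)).mono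
        (comap_le_pastSigma (i := Sum.inl n) n.lt_succ_self) le_rfl
    have hZ : Measurable[pastSigma S Z (n + 1)] (Z n) :=
      (comap_measurable (Z n)).mono
        (comap_le_pastSigma (i := Sum.inr n) n.lt_succ_self) le_rfl
    exact (measurable_chainStep r xs δ).comp
      ((ih.mono (pastSigma_mono n.le_succ) le_rfl).prodMk (hS.prodMk hZ))

end PastSigma

section Probability

variable {Ω : Type*} [MeasurableSpace Ω] {P : Measure Ω} {S Z : ℕ → Ω → ℝ}

theorem iIndepFun_sumElim [IsProbabilityMeasure P] (hS : iIndepFun S P) (hZ : iIndepFun Z P)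
    (hSZ : IndepFun (fun ω i => S i ω) (fun ω i => Z i ω) P) :
    iIndepFun (fun i : ℕ ⊕ ℕ => Sum.elim S Z i) P := by
  rw [iIndepFun_iff_measure_inter_preimage_eq_mul]
  intro s sets hsets
  have hl : ⋂ i ∈ s.toLeft, S i ⁻¹' sets (Sum.inl i) =
      (fun ω i => S i ω) ⁻¹' ⋂ i ∈ s.toLeft, (fun f : ℕ → ℝ => f i) ⁻¹' sets (Sum.inl i) := by
    ext ω; simp
  have hrt : ⋂ i ∈ s.toRight, Z i ⁻¹' sets (Sum.inr i) =
      (fun ω i => Z i ω) ⁻¹' ⋂ i ∈ s.toRight, (fun f : ℕ → ℝ => f i) ⁻¹' sets (Sum.inr i) := by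
    ext ω; simp
  have hsplit : ⋂ i ∈ s, (Sum.elim S Z i) ⁻¹' sets i =
      (⋂ i ∈ s.toLeft, S i ⁻¹' sets (Sum.inl i)) ∩
        ⋂ i ∈ s.toRight, Z i ⁻¹' sets (Sum.inr i) := by
    ext ω
    simp only [Set.mem_iInter, Set.mem_inter_iff, Finset.mem_toLeft, Finset.mem_toRight]
    exact ⟨fun h => ⟨fun i hi => h _ hi, fun i hi => h _ hi⟩, fun h i hi => by
      cases i with
      | inl i => exact h.1 i hi
      | inr i => exact h.2 i hi⟩
  rw [hsplit, hl, hrt, hSZ.measure_inter_preimage_eq_mul _ _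
    (Finset.measurableSet_biInter _ fun i hi => measurable_pi_apply i
      (hsets _ (Finset.mem_toLeft.1 hi)))
    (Finset.measurableSet_biInter _ fun i hi => measurable_pi_apply i
      (hsets _ (Finset.mem_toRight.1 hi))), ← hl, ← hrt,
    hS.measure_inter_preimage_eq_mul _ fun i hi => hsets _ (Finset.mem_toLeft.1 hi),
    hZ.measure_inter_preimage_eq_mul _ fun i hi => hsets _ (Finset.mem_toRight.1 hi)]
  conv_rhs => rw [← Finset.toLeft_disjSum_toRight (u := s), Finset.prod_disjSum]
  rfl

theorem pastSigma_le (hS : ∀ i, Measurable (S i)) (hZ : ∀ i, Measurable (Z i)) (n : ℕ) :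
    pastSigma S Z n ≤ ‹MeasurableSpace Ω› :=
  iSup₂_le fun i _ => by
    cases i with
    | inl i => exact (hS i).comap_le
    | inr i => exact (hZ i).comap_le

theorem measurable_stoppedChain (hS : ∀ i, Measurable (S i)) (hZ : ∀ i, Measurable (Z i))
    (r xs δ x : ℝ) (n : ℕ) :
    Measurable fun ω => stoppedChain r xs δ x (fun i => S i ω) (fun i => Z i ω) n :=
  (measurable_stoppedChain_pastSigma r xs δ x n).mono (pastSigma_le hS hZ n) le_rfl

/-- The chain after n events uses only the inputs with index below n, and the next step uses those
with index n; the two index sets are disjoint. -/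
theorem indepFun_stoppedChain (hS : ∀ i, Measurable (S i)) (hZ : ∀ i, Measurable (Z i))
    (h : iIndepFun (fun i : ℕ ⊕ ℕ => Sum.elim S Z i) P) (r xs δ x : ℝ) (n : ℕ) :
    IndepFun (fun ω => stoppedChain r xs δ x (fun i => S i ω) (fun i => Z i ω) n)
      (fun ω => (S n ω, Z n ω)) P := by
  rw [IndepFun_iff_Indep]
  have hind := indep_iSup_of_disjoint
    (m := fun i : ℕ ⊕ ℕ => MeasurableSpace.comap (Sum.elim S Z i) inferInstance) (fun i => by
      cases i with
      | inl i => exact (hS i).comap_le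
      | inr i => exact (hZ i).comap_le) h.iIndep
    (S := {i : ℕ ⊕ ℕ | Sum.elim id id i < n}) (T := {i : ℕ ⊕ ℕ | Sum.elim id id i = n}) (by
      rw [Set.disjoint_left]
      intro i hi hi'
      simp only [Set.mem_ofPred_eq] at hi hi'
      omega)
  refine indep_of_indep_of_le_left (indep_of_indep_of_le_right hind ?_)
    (measurable_stoppedChain_pastSigma r xs δ x n).comap_le
  refine Measurable.comap_le ?_
  refine Measurable.prodMk ?_ ?_
  · exact (comap_measurable (S n)).mono (le_iSup₂_of_le (Sum.inl n) rfl le_rfl) le_rfl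
  · exact (comap_measurable (Z n)).mono (le_iSup₂_of_le (Sum.inr n) rfl le_rfl) le_rfl

/-- The expectation along the stopped chain as an iterate of its transition operator. -/
theorem lintegral_stoppedChain [IsProbabilityMeasure P] {μ : Measure (ℝ × ℝ)}
    [IsProbabilityMeasure μ]
    (hS : ∀ i, Measurable (S i)) (hZ : ∀ i, Measurable (Z i))
    (h : iIndepFun (fun i : ℕ ⊕ ℕ => Sum.elim S Z i) P)
    (hμ : ∀ n, P.map (fun ω => (S n ω, Z n ω)) = μ) (r xs δ x : ℝ) (n : ℕ)
    {g : ℝ → ℝ≥0∞} (hg : Measurable g) :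
    ∫⁻ ω, ENNReal.ofReal (stoppedChain r xs δ x (fun i => S i ω) (fun i => Z i ω) n).2 *
      g (stoppedChain r xs δ x (fun i => S i ω) (fun i => Z i ω) n).1 ∂P =
      (stoppedNext r xs δ μ)^[n] g x := by
  induction n generalizing g with
  | zero => simp [stoppedChain]
  | succ n ih =>
    -- The last transition is absorbed into the test function, which is why the induction
    -- generalizes over `g`.
    rw [Function.iterate_succ_apply, ← ih (measurable_stoppedNext hg)]
    have hm := measurable_stoppedChain hS hZ r xs δ x n
    have hlaw := (indepFun_iff_map_prod_eq_prod_map_map hm.aemeasurable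
      ((hS n).prodMk (hZ n)).aemeasurable).1 (indepFun_stoppedChain hS hZ h r xs δ x n)
    rw [hμ n] at hlaw
    let F : ℝ × ℝ → ℝ≥0∞ := fun q => ENNReal.ofReal q.2 * g q.1
    have hF : Measurable F := (by fun_prop : Measurable fun q : ℝ × ℝ => ENNReal.ofReal q.2).mul
      (hg.comp measurable_fst)
    have hFc : Measurable fun q => F (chainStep r xs δ q) := hF.comp (measurable_chainStep r xs δ)
    let G : ℝ × ℝ → ℝ≥0∞ := fun q => ENNReal.ofReal q.2 * stoppedNext r xs δ μ g q.1
    have hG : Measurable G := (by fun_prop : Measurable fun q : ℝ × ℝ => ENNReal.ofReal q.2).mul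
      ((measurable_stoppedNext hg).comp measurable_fst)
    have := Measure.isProbabilityMeasure_map (μ := P) hm.aemeasurable
    calc _ = ∫⁻ ω, F (chainStep r xs δ
            (stoppedChain r xs δ x (fun i => S i ω) (fun i => Z i ω) n, (S n ω, Z n ω))) ∂P := rfl
      _ = ∫⁻ q, F (chainStep r xs δ q)
            ∂(P.map fun ω => stoppedChain r xs δ x (fun i => S i ω) (fun i => Z i ω) n).prod μ := by
          rw [← hlaw, lintegral_map hFc (hm.prodMk ((hS n).prodMk (hZ n)))]
      _ = ∫⁻ q, ∫⁻ p, F (chainStep r xs δ (q, p)) ∂μ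
            ∂(P.map fun ω => stoppedChain r xs δ x (fun i => S i ω) (fun i => Z i ω) n) :=
          lintegral_prod _ hFc.aemeasurable
      _ = ∫⁻ ω, ∫⁻ p, F (chainStep r xs δ
            (stoppedChain r xs δ x (fun i => S i ω) (fun i => Z i ω) n, p)) ∂μ ∂P :=
          lintegral_map hFc.lintegral_prod_right' hm
      _ = ∫⁻ ω, G (stoppedChain r xs δ x (fun i => S i ω) (fun i => Z i ω) n) ∂P := by
          refine lintegral_congr fun ω => ?_
          generalize hq : stoppedChain r xs δ x (fun i => S i ω) (fun i => Z i ω) n = q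
          rcases lt_or_ge q.1 xs with hlt | hge
          · have h1 (p : ℝ × ℝ) : chainStep r xs δ (q, p) = q := if_pos hlt
            simp only [h1, G, F, stoppedNext, if_pos hlt, lintegral_const, measure_univ, mul_one]
          · have h1 (p : ℝ × ℝ) : F (chainStep r xs δ (q, p)) = ENNReal.ofReal q.2 *
                (ENNReal.ofReal (Real.exp (-δ * p.1)) *
                  g (Household.grow r xs p.1 q.1 * p.2)) := by
              rw [chainStep, if_neg hge.not_gt, ← mul_assoc,
                ← ENNReal.ofReal_mul' (Real.exp_pos _).le]
            simp only [h1, G, stoppedNext, if_neg hge.not_gt]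
            exact lintegral_const_mul _ (measurable_discountedNext_integrand_right hg q.1)
      _ = _ := rfl

/-- By the second Borel–Cantelli lemma infinitely many inter-arrival times lie in (1, 2), so the
event times cannot stay bounded. -/
theorem ae_tendsto_eventTimes [IsProbabilityMeasure P] {lam : ℝ} (hlam : 0 < lam)
    {T : ℕ → Ω → ℝ} (hT : IsPoissonEventTimes T lam P) :
    ∀ᵐ ω ∂P, StrictMono (fun i => T i ω) ∧ Tendsto (fun i => T i ω) atTop atTop := by
  have hS (i : ℕ) : Measurable fun ω => T (i + 1) ω - T i ω :=
    (hT.measurable (i + 1)).sub (hT.measurable i)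
  have hpos : ∀ᵐ ω ∂P, ∀ i, 0 < T (i + 1) ω - T i ω := by
    refine ae_all_iff.2 fun i => ?_
    have h := ae_pos_expMeasure lam
    rw [← (hT.hasLaw i).map_eq] at h
    exact ae_of_ae_map (hS i).aemeasurable h
  set s : ℕ → Set Ω := fun i => (fun ω => T (i + 1) ω - T i ω) ⁻¹' Set.Ioo 1 2 with hs
  have hsm (i : ℕ) : MeasurableSet (s i) := hS i measurableSet_Ioo
  have hsi : iIndepSet s P := by
    rw [iIndepSet_iff_meas_biInter hsm]
    intro t
    exact hT.iIndepFun.measure_inter_preimage_eq_mul t fun i _ => measurableSet_Ioo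
  have hsP (i : ℕ) : P (s i) = expMeasure lam (Set.Ioo 1 2) := by
    rw [← (hT.hasLaw i).map_eq, Measure.map_apply (hS i) measurableSet_Ioo]
  have hlimsup := measure_limsup_eq_one hsm hsi (by
    simp only [hsP]
    exact ENNReal.tsum_const_eq_top_of_ne_zero
      (expMeasure_Ioo_ne_zero hlam zero_le_one one_lt_two))
  have hfreq : ∀ᵐ ω ∂P, ω ∈ limsup s atTop :=
    (mem_ae_iff_prob_eq_one (MeasurableSet.measurableSet_limsup hsm)).2 hlimsup
  filter_upwards [hpos, hfreq] with ω hω1 hω2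
  have hmono : StrictMono fun i => T i ω :=
    strictMono_nat_of_lt_succ fun i => by linarith [hω1 i]
  refine ⟨hmono, tendsto_atTop_atTop_of_monotone hmono.monotone fun M => ?_⟩
  have hunb (m : ℕ) : ∃ n, (m : ℝ) ≤ T n ω := by
    induction m with
    | zero => exact ⟨0, by rw [hT.zero]; simp⟩
    | succ m ih =>
      obtain ⟨n, hn⟩ := ih
      rw [mem_limsup_iff_frequently_mem] at hω2
      obtain ⟨k, hk, hk'⟩ := (frequently_atTop.1 hω2) n
      refine ⟨k + 1, ?_⟩
      have h1 : 1 < T (k + 1) ω - T k ω := hk'.1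
      have h2 : T n ω ≤ T k ω := hmono.monotone hk
      push_cast
      linarith
  obtain ⟨m, hm⟩ := exists_nat_ge M
  obtain ⟨n, hn⟩ := hunb m
  exact ⟨n, hm.trans hn⟩

/-- The stopped discounts converge almost surely to the discount at the trapping time and are
bounded by 1, so dominated convergence applies; their expectations are `trappingIter`. -/
theorem trappingLaplace_eq [IsProbabilityMeasure P] {lam α r xs δ x : ℝ} (hlam : 0 < lam)
    (hα : 0 < α) (hδ : 0 ≤ δ) {T : ℕ → Ω → ℝ} (hT : IsPoissonEventTimes T lam P)
    (hZmeas : ∀ i, Measurable (Z i)) (hZlaw : ∀ i, HasLaw (Z i) (betaMeasure α 1) P)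
    (hZindep : iIndepFun Z P) (hTZ : IndepFun (fun ω i => T i ω) (fun ω i => Z i ω) P) :
    ENNReal.ofReal (Household.trappingLaplace P T Z r xs δ x) =
      ⨆ n, trappingIter r xs δ (stepLaw lam α) n x ∧
    0 ≤ Household.trappingLaplace P T Z r xs δ x := by
  have := isProbabilityMeasure_stepLaw hlam hα
  set S : ℕ → Ω → ℝ := fun i ω => T (i + 1) ω - T i ω with hSdef
  have hS (i : ℕ) : Measurable (S i) := (hT.measurable (i + 1)).sub (hT.measurable i)
  have hSZ : IndepFun (fun ω i => S i ω) (fun ω i => Z i ω) P :=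
    hTZ.comp (φ := fun (f : ℕ → ℝ) i => f (i + 1) - f i) (ψ := id)
      (by fun_prop) measurable_id
  have hind := iIndepFun_sumElim hT.iIndepFun hZindep hSZ
  have hμ (n : ℕ) : P.map (fun ω => (S n ω, Z n ω)) = stepLaw lam α := by
    have h1 : IndepFun (S n) (Z n) P := hSZ.comp (φ := fun f : ℕ → ℝ => f n)
      (ψ := fun f : ℕ → ℝ => f n) (measurable_pi_apply n) (measurable_pi_apply n)
    rw [(indepFun_iff_map_prod_eq_prod_map_map (hS n).aemeasurable (hZmeas n).aemeasurable).1 h1,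
      (hT.hasLaw n).map_eq, (hZlaw n).map_eq, stepLaw]
  let f : ℕ → Ω → ℝ := fun n ω => stoppedDiscount r xs δ x (fun i => S i ω) (fun i => Z i ω) n
  have hf0 (n : ℕ) (ω : Ω) : 0 ≤ f n ω := by
    simp only [f, stoppedDiscount]
    split_ifs
    · exact stoppedChain_snd_nonneg n
    · exact le_rfl
  have hfm (n : ℕ) : Measurable (f n) := by
    have hm := measurable_stoppedChain hS hZmeas r xs δ x n
    exact Measurable.ite (measurableSet_lt hm.fst measurable_const) hm.snd measurable_const
  have hae := ae_tendsto_eventTimes hlam hT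
  have hf1 (n : ℕ) : ∀ᵐ ω ∂P, ‖f n ω‖ ≤ 1 := by
    filter_upwards [hae] with ω hω
    rw [Real.norm_eq_abs, abs_of_nonneg (hf0 n ω)]
    simp only [f, stoppedDiscount]
    split_ifs
    · exact stoppedChain_snd_le_one hδ (fun i => sub_nonneg.2 (hω.1.monotone i.le_succ)) n
    · exact zero_le_one
  have hlap : Household.trappingLaplace P T Z r xs δ x =
      ∫ ω, (if Household.trappingTime r xs x (T · ω) (Z · ω) < ∞ then
        Real.exp (-δ * (Household.trappingTime r xs x (T · ω) (Z · ω)).toNNReal) else 0) ∂P := by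
    rw [Household.trappingLaplace, Household.gerberShiu]
    refine integral_congr_ae (ae_of_all _ fun ω => ?_)
    simp only [Set.indicator_apply, Set.mem_ofPred_eq, one_mul]
  have hlim : Tendsto (fun n => ∫ ω, f n ω ∂P) atTop
      (𝓝 (Household.trappingLaplace P T Z r xs δ x)) := by
    rw [hlap]
    refine tendsto_integral_of_dominated_convergence (fun _ => (1 : ℝ))
      (fun n => (hfm n).aestronglyMeasurable) (integrable_const _) hf1 ?_
    filter_upwards [hae] with ω hω
    exact tendsto_stoppedDiscount (hT.zero ω) hω.1 hω.2
  have hiter (n : ℕ) : ENNReal.ofReal (∫ ω, f n ω ∂P) =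
      trappingIter r xs δ (stepLaw lam α) n x := by
    rw [ofReal_integral_eq_lintegral_ofReal
      (Integrable.of_bound (hfm n).aestronglyMeasurable 1 (hf1 n)) (ae_of_all _ (hf0 n)),
      trappingIter, ← lintegral_stoppedChain hS hZmeas hind hμ r xs δ x n
        (measurable_one.indicator measurableSet_Iio)]
    refine lintegral_congr fun ω => ?_
    simp only [f, stoppedDiscount, Set.indicator_apply, Set.mem_Iio, Pi.one_apply]
    split_ifs <;> simp
  refine ⟨?_, ge_of_tendsto' hlim fun n => integral_nonneg (hf0 n)⟩
  refine tendsto_nhds_unique (ENNReal.tendsto_ofReal hlim) ?_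
  simp only [hiter]
  exact tendsto_atTop_iSup fun m n hmn => monotone_trappingIter hmn x

end Probability

theorem proposition1 {Ω : Type*} [MeasurableSpace Ω] (P : Measure Ω) [IsProbabilityMeasure P]
    (r xs lam α δ x a b : ℝ)
    (hr : 0 < r) (hxs : 0 < xs) (hlam : 0 < lam) (hα : 0 < α) (hδ : 0 ≤ δ) (hx : xs ≤ x)
    (T Z : ℕ → Ω → ℝ)
    (hT : IsPoissonEventTimes T lam P)
    (hZmeas : ∀ i, Measurable (Z i))
    (hZlaw : ∀ i, HasLaw (Z i) (betaMeasure α 1) P)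
    (hZindep : iIndepFun Z P)
    (hTZ : IndepFun (fun ω i => T i ω) (fun ω i => Z i ω) P)
    (ha : a = (-(δ + lam - α * r) - √((δ + lam - α * r) ^ 2 + 4 * r * α * δ)) / (2 * r))
    (hb : b = (-(δ + lam - α * r) + √((δ + lam - α * r) ^ 2 + 4 * r * α * δ)) / (2 * r)) :
    -- the hypergeometric series below converge, and the denominator does not vanish
    (∀ z ∈ Set.Icc (0 : ℝ) 1, Summable fun n : ℕ =>
      ordinaryHypergeometricCoefficient b (b - α + 1) (b - a + 1) n * z ^ n) ∧
    ₂F₁ b (b - α + 1) (b - a + 1) (1 : ℝ) ≠ 0 ∧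
    Household.trappingLaplace P T Z r xs δ x =
      lam * ₂F₁ b (b - α + 1) (b - a + 1) (x / xs)⁻¹ /
        ((lam + δ) * ₂F₁ b (b - α + 1) (b - a + 1) (1 : ℝ)) * (x / xs) ^ (-b) := by
  obtain ⟨hsum, hne, hnonneg, hval⟩ := trapping_hypergeometric hr hxs hlam hα hδ hx ha hb
  obtain ⟨hlap, hlap0⟩ := trappingLaplace_eq (r := r) (xs := xs) (x := x) hlam hα hδ hT hZmeas
    hZlaw hZindep hTZ
  refine ⟨fun z hz => summable_mul_pow hsum hz, hne, ?_⟩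
  -- `ENNReal.ofReal` is injective only on nonnegative reals, so the sign of both sides is needed.
  exact (ENNReal.ofReal_eq_ofReal_iff hlap0 hnonneg).1 (hlap.trans hval)
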